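/- **Purely imaginary eigenvalues and zero-sum games.** Let $G\in\mathbb R^{N\times N}$. Consider the first-order dynamics $\dot x=-Gx$ on $[0,\infty)$ and, for $t_0>0$, the NAGD dynamics $\ddot q+\frac3t\dot q+Gq=0$ on $[t_0,\infty)$, with $v=\dot q$. The origin is *stable* for $\dot x=-Gx$ if for every $\varepsilon>0$ there is $\delta>0$ such that $\|x(0)\|<\delta$ implies $\|x(t)\|<\varepsilon$ for all $t\ge 0$; *asymptotically stable* if moreover $x(t)\to0$ for all sufficiently small initial data; *marginally stable* if it is stable but not asymptotically stable. It is stable for NAGD if for every $\varepsilon>0$ there is $\delta>0$ such that $\|q(t_0)\|+\|v(t_0)\|<\delta$ implies $\|q(t)\|+\|v(t)\|<\varepsilon$ for all $t\ge t_0$. For functions of $t\to\infty$, $f=\Theta(g)$ means $f=O(g)$ and $g=O(f)$. Norms are Euclidean. **(A)** Suppose $G$ has an eigenvalue $ib$ with $b\in\mathbb R$, $b\ne0$, and put $\beta=\sqrt{|b|/2}$. 1. *First-order dynamics.* (a) If $w\neq0$ is a left eigenvector, $w^*G=ib\,w^*$, then every trajectory satisfies $w^*x(t)=e^{-ibt}w^*x(0)$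 for $t\ge0$, so $|w^*x(t)|$ is constant. There is a nonconstant trajectory with $x(t+2\pi/|b|)=x(t)$ for all $t\ge 0$, and the origin is not asymptotically stable. (b) If all eigenvalues of $G$ have nonnegative real part and those with real part $0$ are semisimple, then the origin is marginally stable and every trajectory is bounded. 2. *NAGD dynamics* (no further assumption). For every $t_0>0$ the origin is unstable, exponentially with rate $\beta$: (a) for every left eigenvector $w\ne0$ of $ib$ there is a linear subspace $E\subset\mathbb R^{2N}$ of codimension $2$ such that for every trajectory with $(q(t_0),v(t_0))\notin E$ the limit of $|w^*q(t)|\,t^{3/2}e^{-\beta t}$ as $t\to\infty$ exists and is positive; (b) there is a linear subspace $E\subset\mathbb R^{2N}$ of codimension $2$ such that $t^{-3/2}e^{\beta t}=O(\|q(t)\|)$ for every trajectory with $(q(t_0),v(t_0))\notin E$; (c) for every $\varepsilon>0$ there is a trajectory with $\|q(t_0)\|+\|v(t_0)\|<\varepsilon$ and $\|q(t)\|=\Theta(t^{-3/2}e^{\beta t})$. **(B)** Suppose $G^\top=-G$. Then there are symmetric matrices $Q_1,\dots,Q_N$ such that the costs $J_i(x)=x^\top Q_ix$ satisfy $\sum_iJ_i=0$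 and $\partial J_i/\partial x_i(x)=(Gx)_i$ for all $i$ and $x$: $G$ is the pseudo-gradient matrix of a zero-sum game. All eigenvalues of $G$ are purely imaginary or zero. Every first-order trajectory satisfies $\|x(t)\|=\|x(0)\|$ for $t\ge0$, and does not converge if $Gx(0)\neq0$. If $G\ne0$, the origin is marginally stable for the first-order dynamics, and $G$ has an eigenvalue $ib$ with $b\neq0$ such that $|\mu|\le|b|$ for all eigenvalues $\mu$ of $G$; for this $b$, $\beta=\sqrt{|b|/2}$ and every $t_0>0$, every NAGD trajectory satisfies $\|q(t)\|=O(t^{-3/2}e^{\beta t})$, and $\|q(t)\|=\Theta(t^{-3/2}e^{\beta t})$ whenever $(q(t_0),v(t_0))$ lies outside a suitable linear subspace of $\mathbb R^{2N}$ of codimension $2$. -/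

import Mathlib

open Filter Topology Asymptotics
open scoped Matrix

/-- The complexification of a real matrix, as a linear endomorphism of `ℂ^N`. -/
noncomputable def complexEnd {N : ℕ} (G : Matrix (Fin N) (Fin N) ℝ) :
    Module.End ℂ (Fin N → ℂ) :=
  Matrix.toLin' (G.map Complex.ofReal)

/-- The action `x ↦ G x` of a real matrix on Euclidean space. -/
noncomputable def act {N : ℕ} (G : Matrix (Fin N) (Fin N) ℝ)
    (x : EuclideanSpace ℝ (Fin N)) : EuclideanSpace ℝ (Fin N) :=
  WithLp.toLp 2 (G *ᵥ x.ofLp)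

/-- `w` is a left eigenvector of `G` with eigenvalue `μ`: `w ≠ 0` and `w^* G = μ w^*`. -/
def IsLeftEigenvector {N : ℕ} (G : Matrix (Fin N) (Fin N) ℝ) (μ : ℂ) (w : Fin N → ℂ) : Prop :=
  w ≠ 0 ∧ star w ᵥ* G.map Complex.ofReal = μ • star w

/-- The modal coordinate `w^* x` of a real vector `x`. -/
noncomputable def mode {N : ℕ} (w : Fin N → ℂ) (x : EuclideanSpace ℝ (Fin N)) : ℂ :=
  star w ⬝ᵥ fun i => (x i : ℂ)

/-! ### First-order gradient play -/

/-- `x` solves `x' = -G x` on `[0, ∞)`. -/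
def IsFirstOrderSolution {N : ℕ} (G : Matrix (Fin N) (Fin N) ℝ)
    (x : ℝ → EuclideanSpace ℝ (Fin N)) : Prop :=
  ∀ t, 0 ≤ t → HasDerivWithinAt x (-(act G (x t))) (Set.Ici 0) t

/-- Lyapunov stability of the origin for `x' = -G x`. -/
def FirstOrderStable {N : ℕ} (G : Matrix (Fin N) (Fin N) ℝ) : Prop :=
  ∀ ε > 0, ∃ δ > 0, ∀ x : ℝ → EuclideanSpace ℝ (Fin N), IsFirstOrderSolution G x →
    ‖x 0‖ < δ → ∀ t, 0 ≤ t → ‖x t‖ < ε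

/-- Asymptotic stability of the origin for `x' = -G x`: stable and locally attractive. -/
def FirstOrderAsymptoticallyStable {N : ℕ} (G : Matrix (Fin N) (Fin N) ℝ) : Prop :=
  FirstOrderStable G ∧ ∃ δ > 0, ∀ x : ℝ → EuclideanSpace ℝ (Fin N), IsFirstOrderSolution G x →
    ‖x 0‖ < δ → Tendsto x atTop (𝓝 0)

/-- Marginal stability of the origin for `x' = -G x`: stable but not asymptotically stable. -/
def FirstOrderMarginallyStable {N : ℕ} (G : Matrix (Fin N) (Fin N) ℝ) : Prop :=
  FirstOrderStable G ∧ ¬ FirstOrderAsymptoticallyStable G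

/-! ### The accelerated dynamics -/

/-- `(q, v)` solves `x'' + (3/t) x' + G x = 0` on `[t₀, ∞)`, with `q = x` and `v = x'`. -/
def IsNAGDSolution {N : ℕ} (G : Matrix (Fin N) (Fin N) ℝ) (t₀ : ℝ)
    (q v : ℝ → EuclideanSpace ℝ (Fin N)) : Prop :=
  ∀ t, t₀ ≤ t → HasDerivWithinAt q (v t) (Set.Ici t₀) t ∧
    HasDerivWithinAt v (-((3 / t) • v t) - act G (q t)) (Set.Ici t₀) t

/-- Stability of the origin for the accelerated dynamics started at time `t₀`. -/
def NAGDStable {N : ℕ} (G : Matrix (Fin N) (Fin N) ℝ) (t₀ : ℝ) : Prop :=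
  ∀ ε > 0, ∃ δ > 0, ∀ q v : ℝ → EuclideanSpace ℝ (Fin N), IsNAGDSolution G t₀ q v →
    ‖q t₀‖ + ‖v t₀‖ < δ → ∀ t, t₀ ≤ t → ‖q t‖ + ‖v t‖ < ε

/-- The profile `t^(-3/2) e^(β t)` of exponential growth at rate `β`, with the algebraic factor
produced by the damping `3/t`. -/
noncomputable def growthProfile (β : ℝ) (t : ℝ) : ℝ :=
  t ^ (-(3 / 2) : ℝ) * Real.exp (β * t)

/-! ### Games -/

/-- The pseudo-gradient of the costs `J`: its `i`-th entry is `∂J_i/∂x_i`. -/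
noncomputable def pseudoGradient {N : ℕ} (J : Fin N → (Fin N → ℝ) → ℝ)
    (x : Fin N → ℝ) (i : Fin N) : ℝ :=
  deriv (fun s => J i (Function.update x i s)) (x i)

/-- The quadratic costs `J_i(x) = xᵀ Q_i x`. -/
def quadraticCost {N : ℕ} (Q : Fin N → Matrix (Fin N) (Fin N) ℝ)
    (i : Fin N) (x : Fin N → ℝ) : ℝ :=
  x ⬝ᵥ Q i *ᵥ x

/-! ### Ordinary differential equations on a half-line -/

section HalfLine

variable {E : Type*} [NormedAddCommGroup E] [NormedSpace ℝ E]

/-! Everything reduces to scalar modes. Pairing with a left eigenvector `w` of `ib` turns either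
dynamics into a scalar equation for `w^* x`; conversely a right eigenvector `z` carries a scalar
solution `y` back to the real trajectory `Re (y z)`. In first order the scalar equation is a
rotation, whence the constant modulus, the periodic orbits and the failure of attraction.

For the accelerated dynamics write `ib = -κ²` with `Re κ = √(|b|/2) > 0`; this positive real part is
the source of the instability. The substitution `u = t^(3/2) y` removes the damping and gives `u'' =
(κ² + 3/(4t²)) u`, an integrable perturbation of `u'' = κ² u`. Diagonalizing and dividing by
`e^(κt)` leads to the system `IsLevinsonSolution`: one coordinate has integrable derivative, the
other decays, so `e^(-κt) t^(3/2) y` converges. The limit is a linear functional of the initial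
data, nonzero because a solution started late enough on the growing axis stays near it
(`exists_growth_functional`). Composed with the modal coordinate, which maps `ℝ^N` onto `ℂ`, it has
a kernel of real codimension two: the exceptional subspace.

Marginal stability holds because the initial data of bounded complex flows form a subspace that
contains every generalized eigenspace (`boundedFlowSubmodule_eq_top`). For skew `G`, the matrix `iG`
is Hermitian, so an orthonormal basis of left eigenvectors controls the whole norm and the largest
`|b|` sets the growth rate. -/

theorem eq_of_hasDerivWithinAt_Ici_zero {f : ℝ → E} {t₀ : ℝ}
    (h : ∀ t, t₀ ≤ t → HasDerivWithinAt f 0 (Set.Ici t₀) t) {t : ℝ} (ht : t₀ ≤ t) :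
    f t = f t₀ :=
  constant_of_has_deriv_right_zero (a := t₀) (b := t)
    (fun s hs => ((h s hs.1).continuousWithinAt).mono Set.Icc_subset_Ici_self)
    (fun s hs => (h s hs.1).mono (Set.Ici_subset_Ici.2 hs.1)) t ⟨ht, le_rfl⟩

theorem antitoneOn_Ici_of_hasDerivWithinAt_nonpos {f f' : ℝ → ℝ} {t₀ : ℝ}
    (h : ∀ t, t₀ ≤ t → HasDerivWithinAt f (f' t) (Set.Ici t₀) t)
    (hf' : ∀ t, t₀ ≤ t → f' t ≤ 0) : AntitoneOn f (Set.Ici t₀) := by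
  refine antitoneOn_of_hasDerivWithinAt_nonpos (f' := f') (convex_Ici t₀)
    (fun s hs => (h s hs).continuousWithinAt) (fun s hs => ?_) (fun s hs => ?_)
  · rw [interior_Ici] at hs ⊢
    exact (h s (le_of_lt hs)).mono Set.Ioi_subset_Ici_self
  · rw [interior_Ici] at hs
    exact hf' s (le_of_lt hs)

theorem norm_sub_le_of_norm_deriv_le_div_sq {f f' : ℝ → E} {t₀ C : ℝ} (ht₀ : 0 < t₀)
    (h : ∀ t, t₀ ≤ t → HasDerivWithinAt f (f' t) (Set.Ici t₀) t)
    (hf' : ∀ t, t₀ ≤ t → ‖f' t‖ ≤ C / t ^ 2) {s t : ℝ} (hs : t₀ ≤ s) (hst : s ≤ t) :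
    ‖f t - f s‖ ≤ C / s - C / t := by
  have key := image_norm_le_of_norm_deriv_right_le_deriv_boundary' (a := s) (b := t)
    (f := fun x => f x - f s) (f' := f') (B := fun x => C / s - C / x)
    (B' := fun x => C / x ^ 2)
    (fun x hx => (((h x (hs.trans hx.1)).continuousWithinAt).mono
      (fun z hz => hs.trans hz.1)).sub continuousWithinAt_const)
    (fun x hx => ((h x (hs.trans hx.1)).mono (Set.Ici_subset_Ici.2 (hs.trans hx.1))).sub_const _)
    (by simp)
    (by
      refine continuousOn_const.sub (continuousOn_const.div continuousOn_id fun x hx => ?_)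
      exact (ht₀.trans_le (hs.trans hx.1)).ne')
    (fun x hx => by
      have hx0 : x ≠ 0 := (ht₀.trans_le (hs.trans hx.1)).ne'
      have := ((hasDerivAt_inv hx0).const_mul C).const_sub (C / s)
      refine (this.congr_deriv ?_).hasDerivWithinAt
      field_simp)
    (fun x hx => hf' x (hs.trans hx.1))
  exact key ⟨hst, le_rfl⟩

theorem exists_tendsto_of_norm_deriv_le_div_sq [CompleteSpace E] {f f' : ℝ → E} {t₀ C : ℝ}
    (ht₀ : 0 < t₀) (h : ∀ t, t₀ ≤ t → HasDerivWithinAt f (f' t) (Set.Ici t₀) t)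
    (hf' : ∀ t, t₀ ≤ t → ‖f' t‖ ≤ C / t ^ 2) :
    ∃ l, Tendsto f atTop (𝓝 l) := by
  have hC : 0 ≤ C := by
    have := (norm_nonneg _).trans (hf' t₀ le_rfl)
    by_contra hneg
    exact absurd this (not_le.2 (div_neg_of_neg_of_pos (not_le.1 hneg) (by positivity)))
  refine cauchySeq_tendsto_of_complete (Metric.cauchySeq_iff'.2 fun ε hε => ?_)
  refine ⟨max t₀ (C / ε + 1), fun t ht => ?_⟩
  set s := max t₀ (C / ε + 1) with hs
  have hs0 : 0 < s := ht₀.trans_le (le_max_left _ _)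
  have h1 := norm_sub_le_of_norm_deriv_le_div_sq ht₀ h hf' (le_max_left _ _) ht
  rw [dist_eq_norm]
  have h2 : 0 ≤ C / t := div_nonneg hC (hs0.le.trans ht)
  have h3 : C / s < ε := by
    rw [div_lt_iff₀ hs0]
    have : C / ε + 1 ≤ s := le_max_right _ _
    have h4 : C = ε * (C / ε) := by field_simp
    nlinarith
  linarith

/-- A linear equation with bounded continuous coefficients has global solutions. -/
theorem exists_hasDerivWithinAt_linear [CompleteSpace E] {A : ℝ → E →L[ℝ] E}
    (hA : Continuous A) {K : ℝ} (hK : ∀ t, ‖A t‖ ≤ K) (t₀ : ℝ) (x₀ : E) :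
    ∃ x : ℝ → E, x t₀ = x₀ ∧
      ∀ t, t₀ ≤ t → HasDerivWithinAt x (A t (x t)) (Set.Ici t₀) t := by
  have hK0 : 0 ≤ K := (norm_nonneg _).trans (hK 0)
  -- Picard iteration for `e^(-M(t-t₀)) x(t)`: with this weight the integral operator has Lipschitz
  -- constant `K/M < 1` on the whole half-line, so one contraction yields a global solution.
  set M : ℝ := K + 1 with hM
  have hM0 : 0 < M := by positivity
  let I : (ℝ → E) → ℝ → E := fun z σ => Real.exp (M * (σ - t₀)) • A σ (z σ)
  have hI : ∀ z : ℝ → E, Continuous z → Continuous (I z) := fun z hz => by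
    have : Continuous fun σ => A σ (z σ) := hA.clm_apply hz
    fun_prop
  have hint : ∀ z : ℝ → E, ∀ B : ℝ, (∀ σ, ‖z σ‖ ≤ B) → ∀ s, t₀ ≤ s →
      Real.exp (-(M * (s - t₀))) * ‖∫ σ in t₀..s, I z σ‖ ≤ K / M * B := by
    intro z B hB s hs
    have hB0 : 0 ≤ B := (norm_nonneg _).trans (hB 0)
    have h1 : ‖∫ σ in t₀..s, I z σ‖ ≤ ∫ σ in t₀..s, K * B * Real.exp (M * (σ - t₀)) := by
      refine intervalIntegral.norm_integral_le_of_norm_le hs (MeasureTheory.ae_of_all _ fun σ _ => ?_)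
        (Continuous.intervalIntegrable (by fun_prop) _ _)
      rw [norm_smul, Real.norm_of_nonneg (Real.exp_pos _).le, mul_comm]
      exact mul_le_mul_of_nonneg_right (((A σ).le_opNorm _).trans
        (mul_le_mul (hK σ) (hB σ) (norm_nonneg _) hK0)) (Real.exp_pos _).le
    have h2 : ∫ σ in t₀..s, K * B * Real.exp (M * (σ - t₀)) =
        K * B * (Real.exp (M * (s - t₀)) / M - 1 / M) := by
      have hd : ∀ σ ∈ Set.uIcc t₀ s, HasDerivAt
          (fun σ => K * B * (Real.exp (M * (σ - t₀)) / M))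
          (K * B * Real.exp (M * (σ - t₀))) σ := fun σ _ => by
        have := (((((hasDerivAt_id σ).sub_const t₀).const_mul M).exp).div_const M).const_mul (K * B)
        refine this.congr_deriv ?_
        simp only [id]
        field_simp
      rw [intervalIntegral.integral_eq_sub_of_hasDerivAt hd
        (by apply Continuous.intervalIntegrable; fun_prop)]
      simp
      ring
    rw [h2] at h1
    calc Real.exp (-(M * (s - t₀))) * ‖∫ σ in t₀..s, I z σ‖
        ≤ Real.exp (-(M * (s - t₀))) * (K * B * (Real.exp (M * (s - t₀)) / M)) := by
          refine mul_le_mul_of_nonneg_left (h1.trans ?_) (Real.exp_pos _).le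
          refine mul_le_mul_of_nonneg_left ?_ (by positivity)
          have : 0 ≤ 1 / M := by positivity
          linarith
      _ = K / M * B := by
          rw [Real.exp_neg]
          field_simp
  -- Freezing the time at `t₀` to the left lets the operator act on bounded continuous functions on
  -- all of `ℝ`.
  let F : (ℝ → E) → ℝ → E := fun z t =>
    Real.exp (-(M * (max t t₀ - t₀))) • (x₀ + ∫ σ in t₀..max t t₀, I z σ)
  have hFc : ∀ z : ℝ → E, Continuous z → Continuous (F z) := fun z hz => by
    have h1 : Continuous fun s => ∫ σ in t₀..s, I z σ :=
      intervalIntegral.continuous_primitive (fun a b => (hI z hz).intervalIntegrable a b) t₀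
    have h2 : Continuous fun t : ℝ => max t t₀ := by fun_prop
    have h3 := h1.comp h2
    have h4 : Continuous fun t : ℝ => Real.exp (-(M * (max t t₀ - t₀))) := by fun_prop
    exact h4.smul (continuous_const.add h3)
  have hFb : ∀ z : BoundedContinuousFunction ℝ E, ∀ t, ‖F z t‖ ≤ ‖x₀‖ + K / M * ‖z‖ := by
    intro z t
    have hs : t₀ ≤ max t t₀ := le_max_right _ _
    simp only [F, smul_add]
    refine (norm_add_le _ _).trans (add_le_add ?_ ?_)
    · rw [norm_smul, Real.norm_of_nonneg (Real.exp_pos _).le]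
      refine mul_le_of_le_one_left (norm_nonneg _) (Real.exp_le_one_iff.2 ?_)
      have := mul_nonneg hM0.le (sub_nonneg.2 hs)
      linarith
    · rw [norm_smul, Real.norm_of_nonneg (Real.exp_pos _).le]
      exact hint z _ z.norm_coe_le_norm _ hs
  let Φ : BoundedContinuousFunction ℝ E → BoundedContinuousFunction ℝ E := fun z =>
    BoundedContinuousFunction.ofNormedAddCommGroup (F z) (hFc z z.continuous) _ (hFb z)
  obtain ⟨k, hk⟩ : ∃ k : NNReal, (k : ℝ) = K / M := ⟨⟨K / M, by positivity⟩, rfl⟩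
  have hΦ : ContractingWith k Φ := by
    refine ⟨?_, LipschitzWith.of_dist_le_mul fun z z' => ?_⟩
    · rw [← NNReal.coe_lt_coe, hk, NNReal.coe_one, div_lt_one hM0]
      linarith
    · refine (BoundedContinuousFunction.dist_le (by positivity)).2 fun t => ?_
      have hs : t₀ ≤ max t t₀ := le_max_right _ _
      have hsub : F z t - F z' t = Real.exp (-(M * (max t t₀ - t₀))) •
          ∫ σ in t₀..max t t₀, I (fun r => z r - z' r) σ := by
        have : (fun σ => I (fun r => z r - z' r) σ) = fun σ => I z σ - I z' σ := by
          funext σ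
          simp [I, smul_sub]
        rw [this, intervalIntegral.integral_sub ((hI z z.continuous).intervalIntegrable _ _)
          ((hI z' z'.continuous).intervalIntegrable _ _)]
        simp only [F, ← smul_sub]
        congr 1
        abel
      show dist (F z t) (F z' t) ≤ k * dist z z'
      rw [hk, dist_eq_norm, hsub, norm_smul, Real.norm_of_nonneg (Real.exp_pos _).le]
      refine hint _ _ (fun σ => ?_) _ hs
      rw [← dist_eq_norm]
      exact BoundedContinuousFunction.dist_coe_le_dist σ
  obtain ⟨z, hz⟩ : ∃ z, Φ z = z := ⟨_, hΦ.fixedPoint_isFixedPt⟩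
  have hzt : ∀ t, t₀ ≤ t → x₀ + ∫ σ in t₀..t, I z σ = Real.exp (M * (t - t₀)) • z t := by
    intro t ht
    have : F z t = z t := congrArg (fun f : BoundedContinuousFunction ℝ E => f t) hz
    rw [← this]
    simp only [F, max_eq_left ht]
    rw [smul_smul, ← Real.exp_add, add_neg_cancel, Real.exp_zero, one_smul]
  refine ⟨fun t => x₀ + ∫ σ in t₀..t, I z σ, by simp, fun t ht => ?_⟩
  have hd : HasDerivAt (fun t => x₀ + ∫ σ in t₀..t, I z σ) (I z t) t :=
    (intervalIntegral.integral_hasDerivAt_right ((hI z z.continuous).intervalIntegrable _ _)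
      ((hI z z.continuous).stronglyMeasurableAtFilter _ _)
      (hI z z.continuous).continuousAt).const_add x₀
  refine (hd.congr_deriv ?_).hasDerivWithinAt
  simp only [hzt t ht, I, map_smul]

end HalfLine

/-! ### Asymptotic diagonalization of a planar system -/

/-- Comparison with `1/t`: once `γ t ≥ C + 1`, the quantity `(ψ - 1/t) e^(γt)` is nonincreasing, so
`ψ` is at most `1/t` plus an exponentially small term. -/
theorem tendsto_zero_of_hasDerivWithinAt_le {ψ ψ' : ℝ → ℝ} {t₀ γ C : ℝ} (ht₀ : 0 < t₀)
    (hγ : 0 < γ) (hψ : ∀ t, t₀ ≤ t → 0 ≤ ψ t)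
    (h : ∀ t, t₀ ≤ t → HasDerivWithinAt ψ (ψ' t) (Set.Ici t₀) t)
    (h' : ∀ t, t₀ ≤ t → ψ' t ≤ -γ * ψ t + C / t ^ 2) : Tendsto ψ atTop (𝓝 0) := by
  set T := max t₀ ((C + 1) / γ) with hT
  have hT₀ : t₀ ≤ T := le_max_left _ _
  have hanti : AntitoneOn (fun t => (ψ t - 1 / t) * Real.exp (γ * t)) (Set.Ici T) := by
    refine antitoneOn_Ici_of_hasDerivWithinAt_nonpos
      (f' := fun t => (ψ' t + 1 / t ^ 2) * Real.exp (γ * t) +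
        (ψ t - 1 / t) * (Real.exp (γ * t) * γ)) (fun t ht => ?_) (fun t ht => ?_)
    · have ht0 : t ≠ 0 := (ht₀.trans_le (hT₀.trans ht)).ne'
      have h1 := ((h t (hT₀.trans ht)).mono (Set.Ici_subset_Ici.2 hT₀)).sub
        (hasDerivAt_inv ht0).hasDerivWithinAt
      have h2 : HasDerivWithinAt (fun t => Real.exp (γ * t)) (Real.exp (γ * t) * γ)
          (Set.Ici T) t := by
        simpa using (((hasDerivAt_id t).const_mul γ).exp).hasDerivWithinAt
      have h3 := h1.mul h2
      refine (h3.congr_deriv ?_).congr_of_eventuallyEq ?_ ?_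
      · simp only [Pi.sub_apply, one_div]
        ring
      · exact Eventually.of_forall fun s => by simp
      · simp
    · have ht0 : 0 < t := ht₀.trans_le (hT₀.trans ht)
      have h1 := h' t (hT₀.trans ht)
      have h2 : (C + 1) / t ^ 2 ≤ γ / t := by
        rw [div_le_div_iff₀ (by positivity) ht0]
        have : (C + 1) / γ ≤ t := (le_max_right _ _).trans ht
        rw [div_le_iff₀ hγ] at this
        nlinarith
      have h3 : ψ' t + 1 / t ^ 2 + (ψ t - 1 / t) * γ ≤ 0 := by
        have : (C + 1) / t ^ 2 = C / t ^ 2 + 1 / t ^ 2 := by ring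
        have h4 : γ / t = 1 / t * γ := by ring
        nlinarith
      have := mul_nonpos_of_nonpos_of_nonneg h3 (Real.exp_pos (γ * t)).le
      linarith
  set D := (ψ T - 1 / T) * Real.exp (γ * T)
  have hlim : Tendsto (fun t : ℝ => t⁻¹ + D * Real.exp (-(γ * t))) atTop (𝓝 0) := by
    have h1 : Tendsto (fun t : ℝ => Real.exp (-(γ * t))) atTop (𝓝 0) :=
      Real.tendsto_exp_neg_atTop_nhds_zero.comp (tendsto_id.const_mul_atTop hγ)
    simpa using tendsto_inv_atTop_zero.add (h1.const_mul D)
  refine squeeze_zero' ?_ ?_ hlim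
  · filter_upwards [eventually_ge_atTop t₀] with t ht using hψ t ht
  · filter_upwards [eventually_ge_atTop T] with t ht
    have h1 : (ψ t - 1 / t) * Real.exp (γ * t) ≤ D := hanti (Set.mem_Ici.2 le_rfl) ht ht
    rw [Real.exp_neg, ← div_eq_mul_inv, ← sub_le_iff_le_add', le_div_iff₀ (Real.exp_pos _)]
    simpa [one_div] using h1

/-- The system `a' = (k/t²)(a + c)`, `c' = -2κc - (k/t²)(a + c)`: an integrable perturbation of
a diagonal one. -/
def IsLevinsonSolution (κ k : ℂ) (t₀ : ℝ) (a c : ℝ → ℂ) : Prop :=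
  ∀ t, t₀ ≤ t → HasDerivWithinAt a (k / (t : ℂ) ^ 2 * (a t + c t)) (Set.Ici t₀) t ∧
    HasDerivWithinAt c (-2 * κ * c t - k / (t : ℂ) ^ 2 * (a t + c t)) (Set.Ici t₀) t

namespace IsLevinsonSolution

variable {κ k : ℂ} {t₀ : ℝ} {a c : ℝ → ℂ}

theorem mono {t₁ : ℝ} (h : IsLevinsonSolution κ k t₀ a c) (ht : t₀ ≤ t₁) :
    IsLevinsonSolution κ k t₁ a c := fun t ht' =>
  ⟨(h t (ht.trans ht')).1.mono (Set.Ici_subset_Ici.2 ht),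
    (h t (ht.trans ht')).2.mono (Set.Ici_subset_Ici.2 ht)⟩

theorem norm_coupling_le {x y : ℂ} {t : ℝ} (ht : 0 < t) :
    ‖k / (t : ℂ) ^ 2 * (x + y)‖ ≤ ‖k‖ / t ^ 2 * (‖x‖ + ‖y‖) := by
  rw [norm_mul, norm_div, norm_pow, Complex.norm_real, Real.norm_of_nonneg ht.le]
  exact mul_le_mul_of_nonneg_left (norm_add_le _ _) (by positivity)

theorem inner_damping_le {x y : ℂ} {t : ℝ} (ht : 0 < t) :
    inner ℝ y (-2 * κ * y - k / (t : ℂ) ^ 2 * (x + y)) ≤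
      -2 * κ.re * ‖y‖ ^ 2 + ‖k‖ / t ^ 2 * (‖x‖ + ‖y‖) * ‖y‖ := by
  rw [inner_sub_right]
  have h1 : inner ℝ y (-2 * κ * y) = -2 * κ.re * ‖y‖ ^ 2 := by
    rw [Complex.inner, ← Complex.normSq_eq_norm_sq, Complex.normSq_apply]
    simp
    ring
  have h2 : -inner ℝ y (k / (t : ℂ) ^ 2 * (x + y)) ≤
      ‖k‖ / t ^ 2 * (‖x‖ + ‖y‖) * ‖y‖ := by
    refine (neg_le_abs _).trans ((abs_real_inner_le_norm _ _).trans ?_)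
    rw [mul_comm]
    exact mul_le_mul_of_nonneg_right (norm_coupling_le ht) (norm_nonneg _)
  linarith

/-- Gronwall with an integrable rate: the diagonal damping only helps, and `(‖a‖ + ‖c‖)² ≤ 2 (‖a‖² +
‖c‖²)` bounds the logarithmic growth rate of the energy by `4‖k‖/t²`. The weight `e^(4‖k‖/t)`
absorbs exactly that. -/
theorem norm_sq_le (h : IsLevinsonSolution κ k t₀ a c) (ht₀ : 0 < t₀) (hκ : 0 < κ.re)
    {t : ℝ} (ht : t₀ ≤ t) :
    ‖a t‖ ^ 2 + ‖c t‖ ^ 2 ≤ (‖a t₀‖ ^ 2 + ‖c t₀‖ ^ 2) * Real.exp (4 * ‖k‖ / t₀) := by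
  have hanti : AntitoneOn (fun t => (‖a t‖ ^ 2 + ‖c t‖ ^ 2) * Real.exp (4 * ‖k‖ / t))
      (Set.Ici t₀) := by
    refine antitoneOn_Ici_of_hasDerivWithinAt_nonpos
      (f' := fun t => (2 * inner ℝ (a t) (k / (t : ℂ) ^ 2 * (a t + c t)) +
        2 * inner ℝ (c t) (-2 * κ * c t - k / (t : ℂ) ^ 2 * (a t + c t))) *
          Real.exp (4 * ‖k‖ / t) + (‖a t‖ ^ 2 + ‖c t‖ ^ 2) *
          (Real.exp (4 * ‖k‖ / t) * (4 * ‖k‖ * -(t ^ 2)⁻¹))) (fun t ht => ?_) (fun t ht => ?_)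
    · have ht0 : t ≠ 0 := (ht₀.trans_le ht).ne'
      exact ((h t ht).1.norm_sq.add (h t ht).2.norm_sq).mul
        ((((hasDerivAt_inv ht0).const_mul (4 * ‖k‖)).exp).hasDerivWithinAt)
    · have ht0 : 0 < t := ht₀.trans_le ht
      have h1 : inner ℝ (a t) (k / (t : ℂ) ^ 2 * (a t + c t)) ≤
          ‖a t‖ * (‖k‖ / t ^ 2 * (‖a t‖ + ‖c t‖)) :=
        (real_inner_le_norm _ _).trans
          (mul_le_mul_of_nonneg_left (norm_coupling_le ht0) (norm_nonneg _))
      have h2 := inner_damping_le (κ := κ) (k := k) (x := a t) (y := c t) ht0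
      have h3 : 0 ≤ κ.re * ‖c t‖ ^ 2 := by positivity
      have h4 : 0 ≤ ‖k‖ / t ^ 2 * (‖a t‖ - ‖c t‖) ^ 2 := by positivity
      have h5 : 2 * inner ℝ (a t) (k / (t : ℂ) ^ 2 * (a t + c t)) +
        2 * inner ℝ (c t) (-2 * κ * c t - k / (t : ℂ) ^ 2 * (a t + c t)) +
        (‖a t‖ ^ 2 + ‖c t‖ ^ 2) * (4 * ‖k‖ * -(t ^ 2)⁻¹) ≤ 0 := by
        have h6 : 4 * ‖k‖ * -(t ^ 2)⁻¹ = -4 * (‖k‖ / t ^ 2) := by ring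
        rw [h6]
        linear_combination 2 * h1 + 2 * h2 + 4 * h3 + 2 * h4
      have := mul_nonpos_of_nonpos_of_nonneg h5 (Real.exp_pos (4 * ‖k‖ / t)).le
      linarith
  refine le_trans ?_ (hanti (Set.mem_Ici.2 le_rfl) ht ht)
  refine le_mul_of_one_le_right (by positivity) (Real.one_le_exp ?_)
  have : 0 < t := ht₀.trans_le ht
  positivity

theorem norm_add_norm_le (h : IsLevinsonSolution κ k t₀ a c) (ht₀ : 0 < t₀) (hκ : 0 < κ.re)
    {t : ℝ} (ht : t₀ ≤ t) :
    ‖a t‖ + ‖c t‖ ≤ 2 * √((‖a t₀‖ ^ 2 + ‖c t₀‖ ^ 2) * Real.exp (4 * ‖k‖ / t₀)) := by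
  have h1 := h.norm_sq_le ht₀ hκ ht
  have h2 := Real.le_sqrt_of_sq_le
    ((le_add_of_nonneg_right (sq_nonneg ‖c t‖)).trans h1)
  have h3 := Real.le_sqrt_of_sq_le
    ((le_add_of_nonneg_left (sq_nonneg ‖a t‖)).trans h1)
  linarith

theorem norm_coupling_le_div_sq (h : IsLevinsonSolution κ k t₀ a c) (ht₀ : 0 < t₀)
    (hκ : 0 < κ.re) {t : ℝ} (ht : t₀ ≤ t) :
    ‖k / (t : ℂ) ^ 2 * (a t + c t)‖ ≤ ‖k‖ *
      (2 * √((‖a t₀‖ ^ 2 + ‖c t₀‖ ^ 2) * Real.exp (4 * ‖k‖ / t₀))) / t ^ 2 := by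
  have ht0 : 0 < t := ht₀.trans_le ht
  refine (norm_coupling_le ht0).trans ?_
  rw [mul_div_right_comm]
  exact mul_le_mul_of_nonneg_left (h.norm_add_norm_le ht₀ hκ ht) (by positivity)

/-- Boundedness of the solution makes the coupling an `O(1/t²)` forcing, so `‖c‖²` obeys a damped
inequality with rate `4 Re κ`. -/
theorem tendsto_decay (h : IsLevinsonSolution κ k t₀ a c) (ht₀ : 0 < t₀) (hκ : 0 < κ.re) :
    Tendsto c atTop (𝓝 0) := by
  set B := 2 * √((‖a t₀‖ ^ 2 + ‖c t₀‖ ^ 2) * Real.exp (4 * ‖k‖ / t₀)) with hB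
  have hB0 : 0 ≤ B := by positivity
  have hsq : Tendsto (fun t => ‖c t‖ ^ 2) atTop (𝓝 0) := by
    refine tendsto_zero_of_hasDerivWithinAt_le (C := 2 * (‖k‖ * B * B)) ht₀
      (by positivity : 0 < 4 * κ.re) (fun t _ => by positivity)
      (fun t ht => (h t ht).2.norm_sq) (fun t ht => ?_)
    have ht0 : 0 < t := ht₀.trans_le ht
    have h1 := inner_damping_le (κ := κ) (k := k) (x := a t) (y := c t) ht0
    have h2 := h.norm_add_norm_le ht₀ hκ ht
    have h3 : ‖k‖ / t ^ 2 * (‖a t‖ + ‖c t‖) * ‖c t‖ ≤ ‖k‖ / t ^ 2 * B * B := by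
      have h4 : ‖c t‖ ≤ B := (le_add_of_nonneg_left (norm_nonneg _)).trans h2
      gcongr
    have h5 : 2 * (‖k‖ * B * B) / t ^ 2 = 2 * (‖k‖ / t ^ 2 * B * B) := by ring
    rw [h5]
    linarith
  rw [tendsto_zero_iff_norm_tendsto_zero]
  have := hsq.sqrt
  simpa using this

theorem exists_tendsto (h : IsLevinsonSolution κ k t₀ a c) (ht₀ : 0 < t₀) (hκ : 0 < κ.re) :
    ∃ l, Tendsto (fun t => a t + c t) atTop (𝓝 l) := by
  obtain ⟨l, hl⟩ := exists_tendsto_of_norm_deriv_le_div_sq ht₀ (fun t ht => (h t ht).1)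
    (fun t ht => h.norm_coupling_le_div_sq ht₀ hκ ht)
  exact ⟨l, by simpa using hl.add (h.tendsto_decay ht₀ hκ)⟩

/-- Starting late on the growing axis, the solution stays close to it. -/
theorem limit_ne_zero (h : IsLevinsonSolution κ k t₀ a c) (ht₀ : 0 < t₀) (hκ : 0 < κ.re)
    (ha : a t₀ = 1) (hc : c t₀ = 0)
    (hlarge : 2 * ‖k‖ * √(Real.exp (4 * ‖k‖ / t₀)) / t₀ < 1) {l : ℂ}
    (hl : Tendsto (fun t => a t + c t) atTop (𝓝 l)) : l ≠ 0 := by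
  have hla : Tendsto a atTop (𝓝 l) := by
    simpa using hl.sub (h.tendsto_decay ht₀ hκ)
  have h1 : ‖l - 1‖ ≤ 2 * ‖k‖ * √(Real.exp (4 * ‖k‖ / t₀)) / t₀ := by
    refine le_of_tendsto (hla.sub_const 1).norm ?_
    filter_upwards [eventually_ge_atTop t₀] with t ht
    have h2 := norm_sub_le_of_norm_deriv_le_div_sq ht₀ (fun t ht => (h t ht).1)
      (fun t ht => h.norm_coupling_le_div_sq ht₀ hκ ht) le_rfl ht
    rw [ha, hc] at h2
    have h3 : 0 < t := ht₀.trans_le ht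
    have h4 : 0 ≤ ‖k‖ * (2 * √(Real.exp (4 * ‖k‖ / t₀))) / t := by positivity
    simp only [norm_one, norm_zero, one_pow, ne_eq, OfNat.ofNat_ne_zero, not_false_eq_true,
      zero_pow, add_zero, one_mul] at h2
    calc ‖a t - 1‖ ≤ ‖k‖ * (2 * √(Real.exp (4 * ‖k‖ / t₀))) / t₀ := by linarith
      _ = _ := by ring
  rintro rfl
  simp only [zero_sub, norm_neg, norm_one] at h1
  linarith

end IsLevinsonSolution

/-! ### The scalar damped equation -/

/-- `(y, z)` solves `y'' + (3/t) y' + ν y = 0` on `[t₀, ∞)`, with `z = y'`. -/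
def IsDampedSolution (ν : ℂ) (t₀ : ℝ) (y z : ℝ → ℂ) : Prop :=
  ∀ t, t₀ ≤ t → HasDerivWithinAt y (z t) (Set.Ici t₀) t ∧
    HasDerivWithinAt z (-(3 / (t : ℂ) * z t) - ν * y t) (Set.Ici t₀) t

/-- The coordinate of `(y, z)` along the growing asymptotic direction. -/
noncomputable def growingCoord (κ : ℂ) (y z : ℝ → ℂ) (t : ℝ) : ℂ :=
  Complex.exp (-(κ * t)) * (t ^ (3 / 2 : ℝ) : ℝ) * (κ * y t + (z t + 3 / 2 / (t : ℂ) * y t)) /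
    (2 * κ)

/-- The coordinate of `(y, z)` along the decaying asymptotic direction. -/
noncomputable def decayingCoord (κ : ℂ) (y z : ℝ → ℂ) (t : ℝ) : ℂ :=
  Complex.exp (-(κ * t)) * (t ^ (3 / 2 : ℝ) : ℝ) * (κ * y t - (z t + 3 / 2 / (t : ℂ) * y t)) /
    (2 * κ)

theorem growingCoord_add_decayingCoord {κ : ℂ} (hκ : κ ≠ 0) (y z : ℝ → ℂ) (t : ℝ) :
    growingCoord κ y z t + decayingCoord κ y z t =
      Complex.exp (-(κ * t)) * (t ^ (3 / 2 : ℝ) : ℝ) * y t := by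
  rw [growingCoord, decayingCoord]
  field_simp
  ring

theorem hasDerivAt_exp_mul_rpow (κ : ℂ) {t : ℝ} (ht : 0 < t) :
    HasDerivAt (fun t : ℝ => Complex.exp (-(κ * t)) * ((t ^ (3 / 2 : ℝ) : ℝ) : ℂ))
      (Complex.exp (-(κ * t)) * (t ^ (3 / 2 : ℝ) : ℝ) * (-κ + 3 / 2 / (t : ℂ))) t := by
  have h1 : HasDerivAt (fun t : ℝ => Complex.exp (-(κ * t)))
      (Complex.exp (-(κ * t)) * -(κ * 1)) t :=
    ((Complex.ofRealCLM.hasDerivAt.const_mul κ).neg).cexp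
  have h2 := (Real.hasDerivAt_rpow_const (x := t) (p := 3 / 2) (Or.inl ht.ne')).ofReal_comp
  refine (h1.mul h2).congr_deriv ?_
  rw [Real.rpow_sub_one ht.ne']
  push_cast
  ring

namespace IsDampedSolution

variable {ν κ : ℂ} {t₀ : ℝ} {y z y₁ z₁ y₂ z₂ : ℝ → ℂ}

theorem linear_comb (h₁ : IsDampedSolution ν t₀ y₁ z₁) (h₂ : IsDampedSolution ν t₀ y₂ z₂)
    (A B : ℂ) : IsDampedSolution ν t₀ (fun t => A * y₁ t + B * y₂ t)
      (fun t => A * z₁ t + B * z₂ t) := fun t ht => by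
  refine ⟨((h₁ t ht).1.const_mul A).add ((h₂ t ht).1.const_mul B),
    (((h₁ t ht).2.const_mul A).add ((h₂ t ht).2.const_mul B)).congr_deriv ?_⟩
  ring

/-- With `u = t^(3/2) y` one has `u' = t^(3/2) (z + 3y/(2t))` and `u'' = (κ² + 3/(4t²)) u`. The two
coordinates are `e^(-κt) (κu ± u') / (2κ)`, and the residual potential divided by `2κ` gives the
coupling `3/(8κ)`. -/
theorem isLevinsonSolution (h : IsDampedSolution (-κ ^ 2) t₀ y z) (ht₀ : 0 < t₀) (hκ : κ ≠ 0) :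
    IsLevinsonSolution κ (3 / (8 * κ)) t₀ (growingCoord κ y z) (decayingCoord κ y z) := by
  intro t ht
  have ht0 : 0 < t := ht₀.trans_le ht
  have htC : (t : ℂ) ≠ 0 := by exact_mod_cast ht0.ne'
  have hE := (hasDerivAt_exp_mul_rpow κ ht0).hasDerivWithinAt (s := Set.Ici t₀)
  have hy := (h t ht).1
  have hz := (h t ht).2
  have hi : HasDerivWithinAt (fun s : ℝ => 3 / 2 / (s : ℂ)) (3 / 2 * (-1 / (t : ℂ) ^ 2))
      (Set.Ici t₀) t := by
    have h1 : HasDerivAt (fun s : ℝ => ((s : ℂ))) 1 t := Complex.ofRealCLM.hasDerivAt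
    have h2 := ((h1.inv htC).const_mul (3 / 2)).hasDerivWithinAt (s := Set.Ici t₀)
    simpa [div_eq_mul_inv] using h2
  have hg := hz.add (hi.mul hy)
  rw [growingCoord_add_decayingCoord hκ]
  constructor
  · refine ((hE.mul ((hy.const_mul κ).add hg)).div_const (2 * κ)).congr_deriv ?_
    simp only [Pi.add_apply, Pi.mul_apply]
    field_simp
    ring
  · refine ((hE.mul ((hy.const_mul κ).sub hg)).div_const (2 * κ)).congr_deriv ?_
    simp only [Pi.add_apply, Pi.sub_apply, Pi.mul_apply, decayingCoord]
    field_simp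
    ring

theorem exists_tendsto (h : IsDampedSolution (-κ ^ 2) t₀ y z) (ht₀ : 0 < t₀) (hκ : 0 < κ.re) :
    ∃ l, Tendsto (fun t : ℝ => Complex.exp (-(κ * t)) * (t ^ (3 / 2 : ℝ) : ℝ) * y t)
      atTop (𝓝 l) := by
  have hκ0 : κ ≠ 0 := by
    rintro rfl
    simp at hκ
  obtain ⟨l, hl⟩ := (h.isLevinsonSolution ht₀ hκ0).exists_tendsto ht₀ hκ
  refine ⟨l, hl.congr fun t => growingCoord_add_decayingCoord hκ0 y z t⟩

/-- Uniqueness comes free from the energy bound: zero data have zero energy. -/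
theorem eq_zero (h : IsDampedSolution (-κ ^ 2) t₀ y z) (ht₀ : 0 < t₀) (hκ : 0 < κ.re)
    (hy : y t₀ = 0) (hz : z t₀ = 0) {t : ℝ} (ht : t₀ ≤ t) : y t = 0 := by
  have hκ0 : κ ≠ 0 := by
    rintro rfl
    simp at hκ
  have h1 := (h.isLevinsonSolution ht₀ hκ0).norm_sq_le ht₀ hκ ht
  have ha : growingCoord κ y z t₀ = 0 := by simp [growingCoord, hy, hz]
  have hc : decayingCoord κ y z t₀ = 0 := by simp [decayingCoord, hy, hz]
  rw [ha, hc] at h1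
  simp only [norm_zero, ne_eq, OfNat.ofNat_ne_zero, not_false_eq_true, zero_pow, add_zero,
    zero_mul] at h1
  have h2 : growingCoord κ y z t = 0 := by
    rw [← norm_eq_zero]
    nlinarith [sq_nonneg ‖growingCoord κ y z t‖, sq_nonneg ‖decayingCoord κ y z t‖]
  have h3 : decayingCoord κ y z t = 0 := by
    rw [← norm_eq_zero]
    nlinarith [sq_nonneg ‖growingCoord κ y z t‖, sq_nonneg ‖decayingCoord κ y z t‖]
  have h4 := growingCoord_add_decayingCoord hκ0 y z t
  rw [h2, h3, add_zero] at h4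
  have h5 : ((t ^ (3 / 2 : ℝ) : ℝ) : ℂ) ≠ 0 := by
    exact_mod_cast (Real.rpow_pos_of_pos (ht₀.trans_le ht) _).ne'
  simpa [Complex.exp_ne_zero, h5] using h4.symm

/-- Abel's identity: the damping `3/t` makes `t³` times the Wronskian constant. This replaces
solving backwards in time when data are prescribed at a later instant. -/
theorem wronskian_ne_zero (h₁ : IsDampedSolution ν t₀ y₁ z₁) (h₂ : IsDampedSolution ν t₀ y₂ z₂)
    (ht₀ : 0 < t₀) (h0 : y₁ t₀ * z₂ t₀ - z₁ t₀ * y₂ t₀ ≠ 0) {t : ℝ} (ht : t₀ ≤ t) :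
    y₁ t * z₂ t - z₁ t * y₂ t ≠ 0 := by
  have hconst : (t : ℂ) ^ 3 * (y₁ t * z₂ t - z₁ t * y₂ t) =
      (t₀ : ℂ) ^ 3 * (y₁ t₀ * z₂ t₀ - z₁ t₀ * y₂ t₀) := by
    refine eq_of_hasDerivWithinAt_Ici_zero
      (f := fun t : ℝ => (t : ℂ) ^ 3 * (y₁ t * z₂ t - z₁ t * y₂ t)) (fun s hs => ?_) ht
    have hsC : (s : ℂ) ≠ 0 := by exact_mod_cast (ht₀.trans_le hs).ne'
    have h3 : HasDerivAt (fun s : ℝ => ((s : ℂ)) ^ 3) (3 * (s : ℂ) ^ 2 * 1) s := by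
      have h1 : HasDerivAt (fun s : ℝ => ((s : ℂ))) 1 s := Complex.ofRealCLM.hasDerivAt
      exact (h1.pow 3).congr_deriv (by push_cast; ring)
    refine (h3.hasDerivWithinAt.mul (((h₁ s hs).1.mul (h₂ s hs).2).sub
      ((h₁ s hs).2.mul (h₂ s hs).1))).congr_deriv ?_
    simp only [Pi.sub_apply, Pi.mul_apply]
    field_simp
    ring
  intro hzero
  rw [hzero, mul_zero] at hconst
  have : (t₀ : ℂ) ^ 3 ≠ 0 := pow_ne_zero _ (by exact_mod_cast ht₀.ne')
  exact mul_ne_zero this h0 hconst.symm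

end IsDampedSolution

theorem exists_isDampedSolution (ν : ℂ) {t₀ : ℝ} (ht₀ : 0 < t₀) (p r : ℂ) :
    ∃ y z, IsDampedSolution ν t₀ y z ∧ y t₀ = p ∧ z t₀ = r := by
  let P : ℂ × ℂ →L[ℝ] ℂ × ℂ :=
    (ContinuousLinearMap.snd ℝ ℂ ℂ).prod ((-ν) • ContinuousLinearMap.fst ℝ ℂ ℂ)
  let R : ℂ × ℂ →L[ℝ] ℂ × ℂ :=
    (0 : ℂ × ℂ →L[ℝ] ℂ).prod (ContinuousLinearMap.snd ℝ ℂ ℂ)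
  -- Replacing `t` by `max t t₀` keeps `3/t` bounded and continuous on all of `ℝ` and changes
  -- nothing on the half-line.
  let A : ℝ → ℂ × ℂ →L[ℝ] ℂ × ℂ := fun t => P + (-(3 / max t t₀)) • R
  have hpos : ∀ t : ℝ, 0 < max t t₀ := fun t => ht₀.trans_le (le_max_right _ _)
  have hA : Continuous A := by
    have h1 : Continuous fun t : ℝ => -(3 / max t t₀) :=
      (continuous_const.div (by fun_prop) fun t => (hpos t).ne').neg
    exact continuous_const.add (h1.smul continuous_const)
  have hK : ∀ t, ‖A t‖ ≤ ‖P‖ + 3 / t₀ * ‖R‖ := fun t => by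
    refine (norm_add_le _ _).trans (add_le_add_right ?_ _)
    rw [norm_smul, norm_neg, Real.norm_of_nonneg (div_nonneg (by norm_num) (hpos t).le)]
    gcongr
    exact le_max_right _ _
  obtain ⟨x, hx0, hx⟩ := exists_hasDerivWithinAt_linear hA hK t₀ (p, r)
  refine ⟨fun t => (x t).1, fun t => (x t).2, fun t ht => ?_, by simp [hx0], by simp [hx0]⟩
  have h1 := hx t ht
  have hm : max t t₀ = t := max_eq_left ht
  constructor
  · have h2 := (ContinuousLinearMap.fst ℝ ℂ ℂ).hasFDerivAt.comp_hasDerivWithinAt t h1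
    refine h2.congr_deriv ?_
    simp [A, P, R]
  · have h2 := (ContinuousLinearMap.snd ℝ ℂ ℂ).hasFDerivAt.comp_hasDerivWithinAt t h1
    refine h2.congr_deriv ?_
    simp [A, P, R, hm]
    ring

theorem exists_solution_of_det_ne_zero {F : Type*} [Field F] {a b c d : F}
    (h : a * d - c * b ≠ 0) (p r : F) : ∃ A B, A * a + B * b = p ∧ A * c + B * d = r := by
  refine ⟨(p * d - r * b) / (a * d - c * b), (a * r - c * p) / (a * d - c * b), ?_, ?_⟩
  · rw [div_mul_eq_mul_div, div_mul_eq_mul_div, ← add_div, div_eq_iff h]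
    ring
  · rw [div_mul_eq_mul_div, div_mul_eq_mul_div, ← add_div, div_eq_iff h]
    ring

/-- The coefficient of the growing asymptotics is a nonzero linear functional of the data. -/
theorem exists_growth_functional {κ : ℂ} (hκ : 0 < κ.re) {t₀ : ℝ} (ht₀ : 0 < t₀) :
    ∃ l₁ l₂ : ℂ, (l₁ ≠ 0 ∨ l₂ ≠ 0) ∧ ∀ y z, IsDampedSolution (-κ ^ 2) t₀ y z →
      Tendsto (fun t : ℝ => Complex.exp (-(κ * t)) * (t ^ (3 / 2 : ℝ) : ℝ) * y t) atTop
        (𝓝 (l₁ * y t₀ + l₂ * z t₀)) := by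
  have hκ0 : κ ≠ 0 := by
    rintro rfl
    simp at hκ
  obtain ⟨y₁, z₁, h₁, hy₁, hz₁⟩ := exists_isDampedSolution (-κ ^ 2) ht₀ 1 0
  obtain ⟨y₂, z₂, h₂, hy₂, hz₂⟩ := exists_isDampedSolution (-κ ^ 2) ht₀ 0 1
  obtain ⟨l₁, hl₁⟩ := h₁.exists_tendsto ht₀ hκ
  obtain ⟨l₂, hl₂⟩ := h₂.exists_tendsto ht₀ hκ
  -- Superposition of the two fundamental solutions makes the limit linear in the data.
  have hlim : ∀ A B : ℂ, Tendsto (fun t : ℝ => Complex.exp (-(κ * t)) *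
      (t ^ (3 / 2 : ℝ) : ℝ) * (A * y₁ t + B * y₂ t)) atTop (𝓝 (l₁ * A + l₂ * B)) := by
    intro A B
    refine ((hl₁.mul_const A).add (hl₂.mul_const B)).congr fun t => ?_
    ring
  refine ⟨l₁, l₂, ?_, fun y z h => ?_⟩
  · by_contra hcon
    obtain ⟨rfl, rfl⟩ : l₁ = 0 ∧ l₂ = 0 := by tauto
    set k : ℂ := 3 / (8 * κ)
    -- If both coefficients vanished, every solution would have limit zero. This `T` is late enough
    -- for `limit_ne_zero`: `e^(4‖k‖/T) ≤ e ≤ 4` and `4‖k‖ < T`.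
    set T := max t₀ (4 * ‖k‖ + 1) with hT
    have hT₀ : t₀ ≤ T := le_max_left _ _
    have hT0 : 0 < T := ht₀.trans_le hT₀
    have hTC : (T : ℂ) ≠ 0 := by exact_mod_cast hT0.ne'
    have hTk : 4 * ‖k‖ + 1 ≤ T := le_max_right _ _
    have hW := h₁.wronskian_ne_zero h₂ ht₀ (by simp [hy₁, hz₁, hy₂, hz₂]) hT₀
    set s : ℂ := Complex.exp (-(κ * T)) * ((T ^ (3 / 2 : ℝ) : ℝ) : ℂ) with hs
    have hs0 : s ≠ 0 := mul_ne_zero (Complex.exp_ne_zero _)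
      (by exact_mod_cast (Real.rpow_pos_of_pos hT0 _).ne')
    -- The values `p` of `y` and `r` of `z` at time `T` for which the growing coordinate is 1 and
    -- the decaying one is 0.
    set p : ℂ := 1 / s
    set r : ℂ := (κ - 3 / 2 / (T : ℂ)) / s
    obtain ⟨A, B, hp, hr⟩ := exists_solution_of_det_ne_zero hW p r
    have hL := ((h₁.linear_comb h₂ A B).isLevinsonSolution ht₀ hκ0).mono hT₀
    refine hL.limit_ne_zero hT0 hκ ?_ ?_ ?_ (l := 0 * A + 0 * B) ?_ (by simp)
    · simp only [growingCoord, hp, hr]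
      rw [← hs]
      simp only [p, r]
      field_simp
      ring
    · simp only [decayingCoord, hp, hr]
      rw [← hs]
      simp only [p, r]
      field_simp
      ring
    · have h4 : √(Real.exp (4 * ‖k‖ / T)) ≤ 2 := by
        rw [Real.sqrt_le_left (by norm_num)]
        have : 4 * ‖k‖ / T ≤ 1 := by
          rw [div_le_one hT0]
          linarith
        refine (Real.exp_le_exp.2 this).trans ?_
        have := Real.exp_one_lt_d9
        norm_num at this ⊢
        linarith
      rw [div_lt_one hT0]
      nlinarith [norm_nonneg k]
    · exact (hlim A B).congr fun t => (growingCoord_add_decayingCoord hκ0 _ _ t).symm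
  · refine (hlim (y t₀) (z t₀)).congr' ?_
    filter_upwards [eventually_ge_atTop t₀] with t ht
    have h3 := (h.linear_comb (h₁.linear_comb h₂ (y t₀) (z t₀)) 1 (-1)).eq_zero ht₀ hκ
      (by simp [hy₁, hy₂]) (by simp [hz₁, hz₂]) ht
    have h4 : y t = y t₀ * y₁ t + z t₀ * y₂ t := by linear_combination h3
    rw [h4]

/-! ### Growth rate of an imaginary mode -/

/-- The root is `κ = β - ib/(2β)` with `β² = |b|/2`: the real part of `κ²` cancels because `b²/(4β²)
= |b|/2`. -/
theorem exists_sq_eq_neg_mul_I {b : ℝ} (hb : b ≠ 0) :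
    ∃ κ : ℂ, κ.re = √(|b| / 2) ∧ 0 < κ.re ∧ -κ ^ 2 = b * Complex.I := by
  have hβ : 0 < √(|b| / 2) := Real.sqrt_pos.2 (by positivity)
  refine ⟨⟨√(|b| / 2), -b / (2 * √(|b| / 2))⟩, rfl, hβ, ?_⟩
  have h1 : √(|b| / 2) ^ 2 = |b| / 2 := Real.sq_sqrt (by positivity)
  have h2 : |b| ^ 2 = b ^ 2 := sq_abs b
  generalize √(|b| / 2) = β at hβ h1
  apply Complex.ext
  · simp only [sq, Complex.neg_re, Complex.mul_re, Complex.ofReal_re, Complex.ofReal_im,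
      Complex.I_re, Complex.I_im]
    field_simp
    have h3 : β ^ 4 = (|b| / 2) ^ 2 := by rw [← h1]; ring
    linear_combination (-4) * h3 - h2
  · simp only [sq, Complex.neg_im, Complex.mul_im, Complex.ofReal_re, Complex.ofReal_im,
      Complex.I_re, Complex.I_im]
    field_simp
    ring

theorem growthProfile_pos (β : ℝ) {t : ℝ} (ht : 0 < t) : 0 < growthProfile β t :=
  mul_pos (Real.rpow_pos_of_pos ht _) (Real.exp_pos _)

theorem norm_exp_mul_rpow_mul (κ y : ℂ) {t : ℝ} (ht : 0 < t) :
    ‖Complex.exp (-(κ * t)) * (t ^ (3 / 2 : ℝ) : ℝ) * y‖ = ‖y‖ / growthProfile κ.re t := by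
  rw [norm_mul, norm_mul, Complex.norm_exp, Complex.norm_real,
    Real.norm_of_nonneg (Real.rpow_pos_of_pos ht _).le, growthProfile, Real.rpow_neg ht.le]
  simp only [Complex.neg_re, Complex.mul_re, Complex.ofReal_re, Complex.ofReal_im, mul_zero,
    sub_zero, Real.exp_neg]
  have := (Real.rpow_pos_of_pos ht (3 / 2)).ne'
  field_simp

theorem exists_norm_growth_functional {b : ℝ} (hb : b ≠ 0) {t₀ : ℝ} (ht₀ : 0 < t₀) :
    ∃ l₁ l₂ : ℂ, (l₁ ≠ 0 ∨ l₂ ≠ 0) ∧ ∀ y z, IsDampedSolution (b * Complex.I) t₀ y z →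
      Tendsto (fun t => ‖y t‖ / growthProfile √(|b| / 2) t) atTop
        (𝓝 ‖l₁ * y t₀ + l₂ * z t₀‖) := by
  obtain ⟨κ, hκ, hκ0, hκb⟩ := exists_sq_eq_neg_mul_I hb
  obtain ⟨l₁, l₂, hl, h⟩ := exists_growth_functional hκ0 ht₀
  refine ⟨l₁, l₂, hl, fun y z hyz => ?_⟩
  rw [← hκb] at hyz
  refine (h y z hyz).norm.congr' ?_
  filter_upwards [eventually_gt_atTop 0] with t ht
  rw [norm_exp_mul_rpow_mul κ _ ht, hκ]

theorem isBigO_growthProfile_of_tendsto {f : ℝ → ℂ} {β C : ℝ}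
    (h : Tendsto (fun t => ‖f t‖ / growthProfile β t) atTop (𝓝 C)) :
    f =O[atTop] growthProfile β := by
  refine IsBigO.of_bound (C + 1) ?_
  filter_upwards [h.eventually (gt_mem_nhds (lt_add_one C)), eventually_gt_atTop 0] with t ht ht0
  have := growthProfile_pos β ht0
  rw [Real.norm_of_nonneg this.le]
  rw [div_lt_iff₀ this] at ht
  exact ht.le

theorem growthProfile_isBigO_of_tendsto {f : ℝ → ℂ} {β C : ℝ} (hC : 0 < C)
    (h : Tendsto (fun t => ‖f t‖ / growthProfile β t) atTop (𝓝 C)) :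
    growthProfile β =O[atTop] f := by
  refine IsBigO.of_bound (2 / C) ?_
  filter_upwards [h.eventually (lt_mem_nhds (half_lt_self hC)), eventually_gt_atTop 0] with t ht ht0
  have := growthProfile_pos β ht0
  rw [Real.norm_of_nonneg this.le]
  rw [lt_div_iff₀ this] at ht
  rw [div_mul_eq_mul_div, le_div_iff₀ hC]
  linarith

theorem tendsto_growthProfile {β : ℝ} (hβ : 0 < β) : Tendsto (growthProfile β) atTop atTop := by
  have h := tendsto_exp_mul_div_rpow_atTop (3 / 2) β hβ
  refine h.congr' ?_
  filter_upwards [eventually_gt_atTop 0] with t ht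
  rw [growthProfile, Real.rpow_neg ht.le]
  ring

theorem growthProfile_isBigO {β β' : ℝ} (h : β ≤ β') :
    growthProfile β =O[atTop] growthProfile β' := by
  refine IsBigO.of_bound 1 ?_
  filter_upwards [eventually_gt_atTop 0] with t ht
  rw [Real.norm_of_nonneg (growthProfile_pos β ht).le,
    Real.norm_of_nonneg (growthProfile_pos β' ht).le, one_mul]
  exact mul_le_mul_of_nonneg_left (Real.exp_le_exp.2 (by nlinarith))
    (Real.rpow_pos_of_pos ht _).le

/-! ### Modal coordinates -/

section Modes

variable {N : ℕ} {G : Matrix (Fin N) (Fin N) ℝ} {μ : ℂ} {w z : Fin N → ℂ}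

/-- The modal coordinate as a continuous real-linear map. -/
noncomputable def modeCLM (w : Fin N → ℂ) : EuclideanSpace ℝ (Fin N) →L[ℝ] ℂ :=
  LinearMap.toContinuousLinearMap
    { toFun := mode w
      map_add' := fun x y => by
        simp [mode, dotProduct, mul_add, Finset.sum_add_distrib]
      map_smul' := fun c x => by
        simp only [mode, dotProduct, PiLp.smul_apply, smul_eq_mul, Complex.ofReal_mul,
          RingHom.id_apply, Complex.real_smul, Finset.mul_sum]
        exact Finset.sum_congr rfl fun i _ => by ring }

@[simp]
theorem modeCLM_apply (w : Fin N → ℂ) (x : EuclideanSpace ℝ (Fin N)) :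
    modeCLM w x = mode w x := rfl

theorem mode_act (hw : star w ᵥ* G.map Complex.ofReal = μ • star w)
    (x : EuclideanSpace ℝ (Fin N)) : mode w (act G x) = μ * mode w x := by
  have h : (fun i => ((act G x) i : ℂ)) = G.map Complex.ofReal *ᵥ fun i => (x i : ℂ) := by
    funext i
    simp [act, Matrix.mulVec, dotProduct]
  rw [mode, h, Matrix.dotProduct_mulVec, hw, smul_dotProduct, smul_eq_mul, mode]

theorem IsNAGDSolution.mode {t₀ : ℝ} {q v : ℝ → EuclideanSpace ℝ (Fin N)}
    (h : IsNAGDSolution G t₀ q v) (hw : star w ᵥ* G.map Complex.ofReal = μ • star w) :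
    IsDampedSolution μ t₀ (fun t => mode w (q t)) (fun t => mode w (v t)) := fun t ht => by
  refine ⟨(modeCLM w).hasFDerivAt.comp_hasDerivWithinAt t (h t ht).1,
    ((modeCLM w).hasFDerivAt.comp_hasDerivWithinAt t (h t ht).2).congr_deriv ?_⟩
  rw [map_sub, map_neg, map_smul]
  simp [mode_act hw]

theorem mode_isBigO (w : Fin N → ℂ) (q : ℝ → EuclideanSpace ℝ (Fin N)) :
    (fun t => mode w (q t)) =O[atTop] fun t => ‖q t‖ :=
  IsBigO.of_bound ‖modeCLM w‖ (Eventually.of_forall fun t => by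
    rw [norm_norm]
    exact (modeCLM w).le_opNorm (q t))

/-- Applying `G` multiplies the mode by `ib`, a scaled quarter turn. Hence `x` and `G x` have modes
independent over `ℝ` as soon as the mode of `x` is nonzero. -/
theorem IsLeftEigenvector.mode_surjective {b : ℝ} (hb : b ≠ 0)
    (hw : IsLeftEigenvector G (b * Complex.I) w) (m : ℂ) : ∃ x, mode w x = m := by
  obtain ⟨j, hj⟩ := Function.ne_iff.1 hw.1
  have he : mode w (EuclideanSpace.single j 1) = star (w j) := by
    simp [mode, dotProduct, apply_ite]
  have he0 : star (w j) ≠ 0 := by simpa using hj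
  set s := m / star (w j) with hs
  refine ⟨s.re • EuclideanSpace.single j 1 +
    (s.im / b) • act G (EuclideanSpace.single j 1), ?_⟩
  rw [← modeCLM_apply, map_add, map_smul, map_smul, modeCLM_apply, modeCLM_apply,
    mode_act hw.2, he, Complex.real_smul, Complex.real_smul]
  have hbC : (b : ℂ) ≠ 0 := by exact_mod_cast hb
  calc (s.re : ℂ) * star (w j) + ((s.im / b : ℝ) : ℂ) * (b * Complex.I * star (w j))
      = (s.re + s.im * Complex.I) * star (w j) := by
        push_cast
        field_simp
    _ = m := by rw [Complex.re_add_im, hs, div_mul_cancel₀ _ he0]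

theorem exists_mulVec_eq_of_hasEigenvalue (h : (complexEnd G).HasEigenvalue μ) :
    ∃ z : Fin N → ℂ, z ≠ 0 ∧ G.map Complex.ofReal *ᵥ z = μ • z := by
  obtain ⟨z, hz⟩ := h.exists_hasEigenvector
  exact ⟨z, hz.2, by simpa [complexEnd] using hz.apply_eq_smul⟩

/-- A singular square matrix has null vectors on both sides. -/
theorem exists_isLeftEigenvector (h : (complexEnd G).HasEigenvalue μ) :
    ∃ w, IsLeftEigenvector G μ w := by
  obtain ⟨z, hz0, hz⟩ := exists_mulVec_eq_of_hasEigenvalue h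
  have h1 : (G.map Complex.ofReal - μ • (1 : Matrix (Fin N) (Fin N) ℂ)).det = 0 :=
    Matrix.exists_mulVec_eq_zero_iff.1
      ⟨z, hz0, by rw [Matrix.sub_mulVec, hz, Matrix.smul_mulVec, Matrix.one_mulVec, sub_self]⟩
  obtain ⟨w, hw0, hw⟩ := Matrix.exists_vecMul_eq_zero_iff.2 h1
  refine ⟨star w, by simpa using hw0, ?_⟩
  rw [star_star]
  rw [Matrix.vecMul_sub, Matrix.vecMul_smul, Matrix.vecMul_one] at hw
  exact sub_eq_zero.1 hw

/-! ### Real solutions carried by one complex eigenvector -/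

/-- The real vectors `Re (y z)`, as a real-linear function of the amplitude `y`. -/
noncomputable def modeReal (z : Fin N → ℂ) : ℂ →L[ℝ] EuclideanSpace ℝ (Fin N) :=
  LinearMap.toContinuousLinearMap
    { toFun := fun y => WithLp.toLp 2 fun i => (y * z i).re
      map_add' := fun x y => by
        ext i
        simp [add_mul]
      map_smul' := fun c x => by
        ext i
        simp
        ring }

theorem modeReal_apply (z : Fin N → ℂ) (y : ℂ) (i : Fin N) : modeReal z y i = (y * z i).re :=
  rfl

theorem act_modeReal (hz : G.map Complex.ofReal *ᵥ z = μ • z) (y : ℂ) :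
    act G (modeReal z y) = modeReal z (μ * y) := by
  ext i
  have h := congrFun hz i
  rw [modeReal_apply]
  have h2 : μ * y * z i = y * (μ • z) i := by simp; ring
  rw [h2, ← h]
  simp only [act, Matrix.mulVec, dotProduct, Matrix.map_apply, Finset.mul_sum, Complex.re_sum,
    modeReal_apply]
  refine Finset.sum_congr rfl fun j _ => ?_
  simp
  ring

/-- The kernel is stable under multiplication by `ib`, so vanishing of `Re (y z)` forces vanishing
of `Im (y z)`. -/
theorem modeReal_injective {b : ℝ} (hb : b ≠ 0) (hz0 : z ≠ 0)
    (hz : G.map Complex.ofReal *ᵥ z = (b * Complex.I) • z) :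
    Function.Injective (modeReal z) := by
  rw [injective_iff_map_eq_zero]
  intro y hy
  have h1 : modeReal z (b * Complex.I * y) = 0 := by
    rw [← act_modeReal hz, hy]
    ext i
    simp [act]
  obtain ⟨j, hj⟩ := Function.ne_iff.1 hz0
  have h2 : (y * z j).re = 0 := by rw [← modeReal_apply, hy]; rfl
  have h3 : (b * Complex.I * y * z j).re = 0 := by rw [← modeReal_apply, h1]; rfl
  have h4 : (b * Complex.I * y * z j).re = -(b * (y * z j).im) := by
    rw [mul_assoc, mul_assoc, Complex.re_ofReal_mul, Complex.I_mul_re]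
    ring
  have h5 : (y * z j).im = 0 := by
    rw [h4, neg_eq_zero] at h3
    exact (mul_eq_zero.1 h3).resolve_left hb
  have h6 : y * z j = 0 := Complex.ext h2 h5
  exact (mul_eq_zero.1 h6).resolve_right hj

/-- Transfers lower bounds on the scalar amplitude to the real trajectory. -/
theorem exists_norm_le_norm_modeReal {b : ℝ} (hb : b ≠ 0) (hz0 : z ≠ 0)
    (hz : G.map Complex.ofReal *ᵥ z = (b * Complex.I) • z) :
    ∃ C : ℝ, 0 < C ∧ ∀ y, ‖y‖ ≤ C * ‖modeReal z y‖ := by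
  obtain ⟨K, hK, h⟩ := (modeReal z).toLinearMap.exists_antilipschitzWith
    (LinearMap.ker_eq_bot.2 (modeReal_injective hb hz0 hz))
  refine ⟨K, by exact_mod_cast hK, fun y => ?_⟩
  have := h.le_mul_dist y 0
  simpa using this

theorem IsDampedSolution.isNAGDSolution {t₀ : ℝ} {y u : ℝ → ℂ} (h : IsDampedSolution μ t₀ y u)
    (hz : G.map Complex.ofReal *ᵥ z = μ • z) :
    IsNAGDSolution G t₀ (fun t => modeReal z (y t)) (fun t => modeReal z (u t)) := fun t ht => by
  refine ⟨(modeReal z).hasFDerivAt.comp_hasDerivWithinAt t (h t ht).1,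
    ((modeReal z).hasFDerivAt.comp_hasDerivWithinAt t (h t ht).2).congr_deriv ?_⟩
  rw [map_sub, map_neg, act_modeReal hz, ← map_smul, Complex.real_smul]
  push_cast
  rfl

/-- Scale scalar data outside the kernel of the growth functional and embed them along a right
eigenvector; the embedding is bounded above and below, so both halves of `Θ` survive. -/
theorem exists_isNAGDSolution_small {b : ℝ} (hb : b ≠ 0)
    (h : (complexEnd G).HasEigenvalue (b * Complex.I)) {t₀ : ℝ} (ht₀ : 0 < t₀) {ε : ℝ}
    (hε : 0 < ε) : ∃ q v : ℝ → EuclideanSpace ℝ (Fin N), IsNAGDSolution G t₀ q v ∧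
      ‖q t₀‖ + ‖v t₀‖ < ε ∧ (fun t => ‖q t‖) =Θ[atTop] growthProfile √(|b| / 2) := by
  obtain ⟨z, hz0, hz⟩ := exists_mulVec_eq_of_hasEigenvalue h
  obtain ⟨l₁, l₂, hl, hlim⟩ := exists_norm_growth_functional hb ht₀
  obtain ⟨C, hC0, hC⟩ := exists_norm_le_norm_modeReal hb hz0 hz
  obtain ⟨p, r, hpr⟩ : ∃ p r : ℂ, l₁ * p + l₂ * r ≠ 0 := by
    rcases hl with hl | hl
    · exact ⟨1, 0, by simpa using hl⟩
    · exact ⟨0, 1, by simpa using hl⟩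
  set D := ‖modeReal z p‖ + ‖modeReal z r‖
  have hD : 0 ≤ D := by positivity
  set η : ℝ := ε / (D + 1) with hη
  have hη0 : 0 < η := by positivity
  obtain ⟨y, u, hyu, hy, hu⟩ := exists_isDampedSolution (b * Complex.I) ht₀ (η • p) (η • r)
  have hY := hlim y u hyu
  have hlim0 : 0 < ‖l₁ * y t₀ + l₂ * u t₀‖ := by
    rw [norm_pos_iff, hy, hu]
    have : l₁ * (η • p) + l₂ * (η • r) = η * (l₁ * p + l₂ * r) := by
      simp only [Complex.real_smul]
      ring
    rw [this]
    exact mul_ne_zero (by exact_mod_cast hη0.ne') hpr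
  refine ⟨_, _, hyu.isNAGDSolution hz, ?_, ?_, ?_⟩
  · simp only [hy, hu, map_smul, norm_smul, Real.norm_of_nonneg hη0.le]
    rw [← mul_add, hη, div_mul_eq_mul_div, div_lt_iff₀ (by positivity)]
    have : D < D + 1 := lt_add_one D
    exact mul_lt_mul_of_pos_left this hε
  · refine IsBigO.trans (IsBigO.of_bound ‖modeReal z‖ (Eventually.of_forall fun t => ?_))
      (isBigO_growthProfile_of_tendsto hY)
    rw [norm_norm]
    exact (modeReal z).le_opNorm (y t)
  · refine (growthProfile_isBigO_of_tendsto hlim0 hY).trans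
      (IsBigO.of_bound C (Eventually.of_forall fun t => ?_))
    rw [norm_norm]
    exact hC (y t)

theorem not_nagdStable {b : ℝ} (hb : b ≠ 0)
    (h : (complexEnd G).HasEigenvalue (b * Complex.I)) {t₀ : ℝ} (ht₀ : 0 < t₀) :
    ¬ NAGDStable G t₀ := by
  intro hs
  obtain ⟨δ, hδ, hs⟩ := hs 1 one_pos
  obtain ⟨q, v, hqv, hsmall, hgrow⟩ := exists_isNAGDSolution_small hb h ht₀ hδ
  have hβ : 0 < √(|b| / 2) := Real.sqrt_pos.2 (by positivity)
  have h1 : growthProfile √(|b| / 2) =O[atTop] fun _ => (1 : ℝ) := by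
    refine hgrow.2.trans (IsBigO.of_bound 1 ?_)
    filter_upwards [eventually_ge_atTop t₀] with t ht
    have := hs q v hqv hsmall t ht
    have h2 := norm_nonneg (v t)
    rw [norm_norm, norm_one, one_mul]
    linarith
  have h2 := (isBigO_one_iff ℝ).1 h1
  exact not_isBoundedUnder_of_tendsto_atTop
    (tendsto_norm_atTop_atTop.comp (tendsto_growthProfile hβ)) h2

/-- `E` is the kernel of the growth functional composed with the mode on positions and velocities.
Surjectivity onto `ℂ`, of real dimension two, gives the codimension. -/
theorem IsLeftEigenvector.exists_submodule {b : ℝ} (hb : b ≠ 0)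
    (hw : IsLeftEigenvector G (b * Complex.I) w) {t₀ : ℝ} (ht₀ : 0 < t₀) :
    ∃ E : Submodule ℝ (EuclideanSpace ℝ (Fin N) × EuclideanSpace ℝ (Fin N)),
      Module.finrank ℝ E + 2 = 2 * N ∧
      ∀ q v : ℝ → EuclideanSpace ℝ (Fin N), IsNAGDSolution G t₀ q v → (q t₀, v t₀) ∉ E →
        ∃ C : ℝ, 0 < C ∧
          Tendsto (fun t => ‖_root_.mode w (q t)‖ / growthProfile √(|b| / 2) t) atTop (𝓝 C) := by
  obtain ⟨l₁, l₂, hl, hlim⟩ := exists_norm_growth_functional hb ht₀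
  let Ψ : EuclideanSpace ℝ (Fin N) × EuclideanSpace ℝ (Fin N) →ₗ[ℝ] ℂ :=
    (l₁ • (modeCLM w).toLinearMap).coprod (l₂ • (modeCLM w).toLinearMap)
  have hΨ : ∀ q v, Ψ (q, v) = l₁ * _root_.mode w q + l₂ * _root_.mode w v := fun q v => by
    simp [Ψ]
  have hsurj : Function.Surjective Ψ := fun m => by
    have h0 : _root_.mode w 0 = 0 := (modeCLM w).map_zero
    rcases hl with hl | hl
    · obtain ⟨x, hx⟩ := hw.mode_surjective hb (m / l₁)
      refine ⟨(x, 0), ?_⟩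
      rw [hΨ, hx, h0]
      field_simp
      simp
    · obtain ⟨x, hx⟩ := hw.mode_surjective hb (m / l₂)
      refine ⟨(0, x), ?_⟩
      rw [hΨ, hx, h0]
      field_simp
      simp
  refine ⟨LinearMap.ker Ψ, ?_, fun q v hqv hE => ?_⟩
  · have h1 := LinearMap.finrank_range_add_finrank_ker Ψ
    rw [LinearMap.range_eq_top.2 hsurj, finrank_top, Complex.finrank_real_complex,
      Module.finrank_prod, finrank_euclideanSpace_fin] at h1
    omega
  · refine ⟨_, ?_, hlim _ _ (hqv.mode hw.2)⟩
    rw [norm_pos_iff]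
    rwa [LinearMap.mem_ker, hΨ] at hE

theorem exists_submodule_growthProfile_isBigO {b : ℝ} (hb : b ≠ 0)
    (h : (complexEnd G).HasEigenvalue (b * Complex.I)) {t₀ : ℝ} (ht₀ : 0 < t₀) :
    ∃ E : Submodule ℝ (EuclideanSpace ℝ (Fin N) × EuclideanSpace ℝ (Fin N)),
      Module.finrank ℝ E + 2 = 2 * N ∧
      ∀ q v : ℝ → EuclideanSpace ℝ (Fin N), IsNAGDSolution G t₀ q v → (q t₀, v t₀) ∉ E →
        growthProfile √(|b| / 2) =O[atTop] (fun t => ‖q t‖) := by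
  obtain ⟨w, hw⟩ := exists_isLeftEigenvector h
  obtain ⟨E, hE, hgrow⟩ := hw.exists_submodule hb ht₀
  refine ⟨E, hE, fun q v hqv hmem => ?_⟩
  obtain ⟨C, hC, hlim⟩ := hgrow q v hqv hmem
  exact (growthProfile_isBigO_of_tendsto hC hlim).trans (mode_isBigO w q)

end Modes

/-! ### First-order dynamics -/

section FirstOrder

variable {N : ℕ} {G : Matrix (Fin N) (Fin N) ℝ} {μ : ℂ} {w z : Fin N → ℂ}

theorem hasDerivAt_cexp_neg_mul (μ : ℂ) (t : ℝ) :
    HasDerivAt (fun t : ℝ => Complex.exp (-(μ * t))) (-μ * Complex.exp (-(μ * t))) t := by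
  have h : HasDerivAt (fun t : ℝ => Complex.exp (-(μ * t)))
      (Complex.exp (-(μ * t)) * -(μ * 1)) t :=
    ((Complex.ofRealCLM.hasDerivAt.const_mul μ).neg).cexp
  exact h.congr_deriv (by ring)

theorem norm_cexp_neg_mul_I (b t : ℝ) : ‖Complex.exp (-(b * Complex.I * t))‖ = 1 := by
  simp [Complex.norm_exp]

theorem IsFirstOrderSolution.mode_eq {x : ℝ → EuclideanSpace ℝ (Fin N)}
    (h : IsFirstOrderSolution G x) (hw : star w ᵥ* G.map Complex.ofReal = μ • star w)
    {t : ℝ} (ht : 0 ≤ t) : mode w (x t) = Complex.exp (-(μ * t)) * mode w (x 0) := by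
  -- The conserved quantity is `e^(μt) w^* x`, written with `-(-μ)` to match
  -- `hasDerivAt_cexp_neg_mul`.
  have hconst : Complex.exp (-(-μ * t)) * mode w (x t) =
      Complex.exp (-(-μ * (0 : ℝ))) * mode w (x 0) := by
    refine eq_of_hasDerivWithinAt_Ici_zero
      (f := fun t : ℝ => Complex.exp (-(-μ * t)) * mode w (x t)) (fun s hs => ?_) ht
    have h1 := (modeCLM w).hasFDerivAt.comp_hasDerivWithinAt s (h s hs)
    refine ((hasDerivAt_cexp_neg_mul (-μ) s).hasDerivWithinAt.mul h1).congr_deriv ?_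
    rw [map_neg, modeCLM_apply, mode_act hw]
    simp only [Function.comp_apply, modeCLM_apply]
    ring
  rw [Complex.ofReal_zero, mul_zero, neg_zero, Complex.exp_zero, one_mul] at hconst
  rw [← hconst, ← mul_assoc, ← Complex.exp_add]
  simp

theorem isFirstOrderSolution_modeReal (hz : G.map Complex.ofReal *ᵥ z = μ • z) (c : ℂ) :
    IsFirstOrderSolution G fun t => modeReal z (Complex.exp (-(μ * t)) * c) := fun t _ => by
  have h := (modeReal z).hasFDerivAt.comp_hasDerivAt t
    ((hasDerivAt_cexp_neg_mul μ t).mul_const c)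
  refine (h.congr_deriv ?_).hasDerivWithinAt
  rw [act_modeReal hz, ← map_neg]
  congr 1
  ring

theorem exists_periodic_firstOrderSolution {b : ℝ} (hb : b ≠ 0)
    (h : (complexEnd G).HasEigenvalue (b * Complex.I)) :
    ∃ x : ℝ → EuclideanSpace ℝ (Fin N), IsFirstOrderSolution G x ∧
      (∀ t, 0 ≤ t → x (t + 2 * Real.pi / |b|) = x t) ∧ ∃ t, 0 ≤ t ∧ x t ≠ x 0 := by
  obtain ⟨z, hz0, hz⟩ := exists_mulVec_eq_of_hasEigenvalue h
  have hbC : (b : ℂ) ≠ 0 := by exact_mod_cast hb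
  have hbC' : ((|b| : ℝ) : ℂ) ≠ 0 := by exact_mod_cast abs_ne_zero.2 hb
  refine ⟨_, isFirstOrderSolution_modeReal hz 1, fun t _ => ?_, Real.pi / |b|, by positivity, ?_⟩
  · simp only [mul_one]
    congr 1
    rw [Complex.exp_eq_exp_iff_exists_int]
    rcases abs_choice b with hs | hs
    · refine ⟨-1, ?_⟩
      rw [hs]
      push_cast
      field_simp
      ring
    · refine ⟨1, ?_⟩
      rw [hs]
      push_cast
      field_simp
      ring
  · intro heq
    have h1 := modeReal_injective hb hz0 hz heq
    -- After half a period the amplitude has changed sign.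
    have h2 : Complex.exp (-(b * Complex.I * ((Real.pi / |b| : ℝ) : ℂ))) = -1 := by
      rcases abs_choice b with hs | hs
      · have : -(b * Complex.I * ((Real.pi / |b| : ℝ) : ℂ)) = -(Real.pi * Complex.I) := by
          rw [hs]
          push_cast
          field_simp
        rw [this, Complex.exp_neg, Complex.exp_pi_mul_I]
        norm_num
      · have : -(b * Complex.I * ((Real.pi / |b| : ℝ) : ℂ)) = Real.pi * Complex.I := by
          rw [hs]
          push_cast
          field_simp
        rw [this, Complex.exp_pi_mul_I]
    rw [h2] at h1
    norm_num at h1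

theorem not_firstOrderAsymptoticallyStable {b : ℝ} (hb : b ≠ 0)
    (h : (complexEnd G).HasEigenvalue (b * Complex.I)) : ¬ FirstOrderAsymptoticallyStable G := by
  rintro ⟨-, δ, hδ, hs⟩
  obtain ⟨z, hz0, hz⟩ := exists_mulVec_eq_of_hasEigenvalue h
  obtain ⟨C, hC0, hC⟩ := exists_norm_le_norm_modeReal hb hz0 hz
  set η : ℝ := δ / (‖modeReal z‖ + 1) with hη
  have hη0 : 0 < η := by positivity
  have hsmall : ‖modeReal z (Complex.exp (-(b * Complex.I * (0 : ℝ))) * η)‖ < δ := by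
    refine ((modeReal z).le_opNorm _).trans_lt ?_
    rw [norm_mul, norm_cexp_neg_mul_I, one_mul, Complex.norm_real, Real.norm_of_nonneg hη0.le,
      hη, ← mul_div_assoc, div_lt_iff₀ (by positivity), mul_comm]
    exact mul_lt_mul_of_pos_left (lt_add_one _) hδ
  have hlim := hs _ (isFirstOrderSolution_modeReal hz (η : ℂ)) hsmall
  -- The amplitude has constant modulus `η`, which contradicts convergence of the trajectory to
  -- zero.
  have h1 : η ≤ C * ‖(0 : EuclideanSpace ℝ (Fin N))‖ := by
    refine ge_of_tendsto (hlim.norm.const_mul C) (Eventually.of_forall fun t => ?_)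
    have := hC (Complex.exp (-(b * Complex.I * t)) * η)
    rwa [norm_mul, norm_cexp_neg_mul_I, one_mul, Complex.norm_real,
      Real.norm_of_nonneg hη0.le] at this
  rw [norm_zero, mul_zero] at h1
  exact absurd h1 (not_le.2 hη0)

/-! ### Boundedness from the spectrum -/

/-- `Z` solves `Z' = -f Z` on `[0, ∞)`, in complex coordinates. -/
def IsComplexFlow (f : Module.End ℂ (Fin N → ℂ)) (Z : ℝ → Fin N → ℂ) : Prop :=
  ∀ t, 0 ≤ t → HasDerivWithinAt Z (-f (Z t)) (Set.Ici 0) t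

/-- The initial data from which `Z' = -f Z` has a bounded forward trajectory. -/
def boundedFlowSubmodule (f : Module.End ℂ (Fin N → ℂ)) : Submodule ℂ (Fin N → ℂ) where
  carrier := {z | ∃ Z, IsComplexFlow f Z ∧ Z 0 = z ∧ ∃ C : ℝ, ∀ t, 0 ≤ t → ‖Z t‖ ≤ C}
  zero_mem' := ⟨fun _ => 0, fun t _ => by simpa using hasDerivWithinAt_const t (Set.Ici 0) 0,
    rfl, 0, by simp⟩
  add_mem' := by
    rintro z z' ⟨Z, hZ, h0, C, hC⟩ ⟨Z', hZ', h0', C', hC'⟩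
    refine ⟨fun t => Z t + Z' t, fun t ht => ?_, by simp [h0, h0'], C + C', fun t ht =>
      (norm_add_le _ _).trans (add_le_add (hC t ht) (hC' t ht))⟩
    refine ((hZ t ht).add (hZ' t ht)).congr_deriv ?_
    rw [map_add]
    abel
  smul_mem' := by
    rintro c z ⟨Z, hZ, h0, C, hC⟩
    refine ⟨fun t => c • Z t, fun t ht => ?_, by simp [h0], ‖c‖ * C, fun t ht => ?_⟩
    · refine ((hZ t ht).const_smul c).congr_deriv ?_
      rw [map_smul, smul_neg]
    · rw [norm_smul]
      exact mul_le_mul_of_nonneg_left (hC t ht) (norm_nonneg c)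

theorem hasDerivAt_neg_pow_div_factorial (j : ℕ) (t : ℝ) :
    HasDerivAt (fun t : ℝ => (-(t : ℂ)) ^ (j + 1) / ((j + 1).factorial : ℂ))
      (-((-(t : ℂ)) ^ j / (j.factorial : ℂ))) t := by
  have h1 : HasDerivAt (fun s : ℝ => -((s : ℂ))) (-1) t := Complex.ofRealCLM.hasDerivAt.neg
  refine ((h1.pow (j + 1)).div_const _).congr_deriv ?_
  have h2 : (j.factorial : ℂ) ≠ 0 := by exact_mod_cast j.factorial_ne_zero
  have h3 : (j : ℂ) + 1 ≠ 0 := by exact_mod_cast j.succ_ne_zero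
  rw [Nat.factorial_succ]
  push_cast
  field_simp

/-- On a generalized eigenvector the exponential series of `-t (f - μ)` terminates. -/
theorem isComplexFlow_genEigenvector {f : Module.End ℂ (Fin N → ℂ)} {m : ℕ}
    (hz : ((f - μ • (1 : Module.End ℂ (Fin N → ℂ))) ^ (m + 1)) z = 0) :
    IsComplexFlow f fun t => Complex.exp (-(μ * t)) • ∑ j ∈ Finset.range (m + 1),
      ((-(t : ℂ)) ^ j / (j.factorial : ℂ)) •
        ((f - μ • (1 : Module.End ℂ (Fin N → ℂ))) ^ j) z := by
  set n := f - μ • (1 : Module.End ℂ (Fin N → ℂ)) with hn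
  have hf : ∀ x, f x = μ • x + n x := fun x => by simp [hn]
  intro t _
  have h1 : HasDerivAt (fun t : ℝ => ∑ j ∈ Finset.range (m + 1),
      ((-(t : ℂ)) ^ j / (j.factorial : ℂ)) • (n ^ j) z)
      (-n (∑ j ∈ Finset.range (m + 1), ((-(t : ℂ)) ^ j / (j.factorial : ℂ)) • (n ^ j) z)) t := by
    have h2 : -n (∑ j ∈ Finset.range (m + 1), ((-(t : ℂ)) ^ j / (j.factorial : ℂ)) • (n ^ j) z) =
        ∑ j ∈ Finset.range m, (-((-(t : ℂ)) ^ j / (j.factorial : ℂ))) • (n ^ (j + 1)) z := by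
      rw [map_sum, Finset.sum_range_succ, map_smul, ← Module.End.mul_apply, ← pow_succ', hz,
        smul_zero, add_zero, ← Finset.sum_neg_distrib]
      refine Finset.sum_congr rfl fun j _ => ?_
      rw [map_smul, ← Module.End.mul_apply, ← pow_succ', neg_smul]
    rw [h2]
    -- The term `j = 0` is constant in time; splitting it off shifts the index to match the
    -- derivative.
    simp only [Finset.sum_range_succ']
    have h3 : HasDerivAt (fun t : ℝ => ∑ j ∈ Finset.range m,
        ((-(t : ℂ)) ^ (j + 1) / ((j + 1).factorial : ℂ)) • (n ^ (j + 1)) z)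
        (∑ j ∈ Finset.range m, (-((-(t : ℂ)) ^ j / (j.factorial : ℂ))) • (n ^ (j + 1)) z) t :=
      HasDerivAt.fun_sum fun j _ => (hasDerivAt_neg_pow_div_factorial j t).smul_const _
    simpa using h3
  refine (((hasDerivAt_cexp_neg_mul μ t).smul h1).congr_deriv ?_).hasDerivWithinAt
  rw [hf, map_smul, smul_neg, smul_smul, neg_mul, neg_smul, neg_add, add_comm]

/-- One term of the exponential series: `(rt)^j / j! ≤ e^(rt)`. -/
theorem norm_neg_pow_div_factorial_mul_exp_le {r : ℝ} (hr : 0 < r) (j : ℕ) {t : ℝ}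
    (ht : 0 ≤ t) : Real.exp (-(r * t)) * ‖(-(t : ℂ)) ^ j / (j.factorial : ℂ)‖ ≤ (r ^ j)⁻¹ := by
  have h1 := Real.pow_div_factorial_le_exp _ (mul_nonneg hr.le ht) j
  rw [norm_div, norm_pow, norm_neg, Complex.norm_real, Real.norm_of_nonneg ht,
    Complex.norm_natCast, Real.exp_neg, inv_mul_le_iff₀ (Real.exp_pos _),
    le_mul_inv_iff₀ (by positivity)]
  refine le_trans (le_of_eq ?_) h1
  rw [mul_pow]
  ring

/-- Generalized eigenspaces span, so it suffices to bound the flow on each: decay beats the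
polynomial factor when `Re μ > 0`, and semisimplicity leaves only `e^(-μt) z` when `Re μ = 0`. -/
theorem boundedFlowSubmodule_eq_top {f : Module.End ℂ (Fin N → ℂ)}
    (hf : ∀ μ : ℂ, f.HasEigenvalue μ → 0 ≤ μ.re ∧ (μ.re = 0 → ∀ z : Fin N → ℂ,
      f (f z - μ • z) = μ • (f z - μ • z) → f z = μ • z)) :
    boundedFlowSubmodule f = ⊤ := by
  rw [eq_top_iff, ← Module.End.iSup_maxGenEigenspace_eq_top f, iSup_le_iff]
  intro μ z hz
  obtain ⟨k, hk⟩ := (Module.End.mem_maxGenEigenspace f μ z).1 hz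
  set n := f - μ • (1 : Module.End ℂ (Fin N → ℂ)) with hn
  have hnz : ∀ x, n x = f x - μ • x := fun x => by simp [hn]
  have hk1 : (n ^ (k + 1)) z = 0 := by rw [pow_succ', Module.End.mul_apply, hk, map_zero]
  by_cases hμ : f.HasEigenvalue μ
  · obtain ⟨hre, hss⟩ := hf μ hμ
    rcases hre.lt_or_eq with hpos | hzero
    · refine ⟨_, isComplexFlow_genEigenvector hk1, ?_,
        ∑ j ∈ Finset.range (k + 1), (μ.re ^ j)⁻¹ * ‖(n ^ j) z‖, fun t ht => ?_⟩
      · simp [Finset.sum_range_succ']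
      · rw [norm_smul, Complex.norm_exp]
        have hre' : (-(μ * t)).re = -(μ.re * t) := by simp
        rw [hre']
        refine (mul_le_mul_of_nonneg_left (norm_sum_le _ _) (Real.exp_pos _).le).trans ?_
        rw [Finset.mul_sum]
        refine Finset.sum_le_sum fun j _ => ?_
        rw [norm_smul, ← mul_assoc]
        exact mul_le_mul_of_nonneg_right (norm_neg_pow_div_factorial_mul_exp_le hpos j ht)
          (norm_nonneg _)
    · have hker : ∀ j, (n ^ (j + 1)) z = 0 → n z = 0 := by
        intro j
        induction j with
        | zero => intro h; simpa using h
        | succ j ih =>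
          intro h
          refine ih ?_
          rw [pow_succ', pow_succ', Module.End.mul_apply, Module.End.mul_apply] at h
          rw [pow_succ', Module.End.mul_apply]
          have h1 := hss hzero.symm ((n ^ j) z)
            (by rw [← hnz]; exact sub_eq_zero.1 ((hnz _).symm.trans h))
          rw [hnz, h1, sub_self]
      have h1 : (n ^ (0 + 1)) z = 0 := by simpa using hker k hk1
      refine ⟨_, isComplexFlow_genEigenvector h1, by simp, ‖z‖, fun t _ => ?_⟩
      rw [norm_smul, Complex.norm_exp]
      simp [← hzero]
  -- The supremum runs over all complex `μ`; if `μ` is not an eigenvalue, its generalized eigenspace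
  -- is trivial.
  · have hinj : ∀ x, n x = 0 → x = 0 := fun x hx => by
      by_contra hx0
      refine hμ (Module.End.hasEigenvalue_of_hasEigenvector
        (Module.End.hasEigenvector_iff.2 ⟨Module.End.mem_eigenspace_iff.2 ?_, hx0⟩))
      rw [hnz] at hx
      exact sub_eq_zero.1 hx
    have : ∀ j, (n ^ j) z = 0 → z = 0 := by
      intro j
      induction j with
      | zero => intro h; simpa using h
      | succ j ih =>
        intro h
        rw [pow_succ', Module.End.mul_apply] at h
        exact ih (hinj _ h)
    rw [this k hk]
    exact Submodule.zero_mem _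

theorem IsComplexFlow.eq {f : Module.End ℂ (Fin N → ℂ)} {Z Z' : ℝ → Fin N → ℂ}
    (hZ : IsComplexFlow f Z) (hZ' : IsComplexFlow f Z') (h0 : Z 0 = Z' 0) {t : ℝ} (ht : 0 ≤ t) :
    Z t = Z' t := by
  let F : (Fin N → ℂ) →L[ℂ] (Fin N → ℂ) := LinearMap.toContinuousLinearMap (-f)
  refine ODE_solution_unique (v := fun _ => F) (K := ‖F‖₊) (a := 0) (b := t)
    (fun _ => F.lipschitz)
    (fun s hs => ((hZ s hs.1).continuousWithinAt).mono Set.Icc_subset_Ici_self)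
    (fun s hs => (hZ s hs.1).mono (Set.Ici_subset_Ici.2 hs.1))
    (fun s hs => ((hZ' s hs.1).continuousWithinAt).mono Set.Icc_subset_Ici_self)
    (fun s hs => (hZ' s hs.1).mono (Set.Ici_subset_Ici.2 hs.1)) h0 ⟨ht, le_rfl⟩

theorem IsFirstOrderSolution.isComplexFlow {x : ℝ → EuclideanSpace ℝ (Fin N)}
    (h : IsFirstOrderSolution G x) :
    IsComplexFlow (complexEnd G) fun t i => ((x t i : ℝ) : ℂ) := fun t ht => by
  rw [hasDerivWithinAt_pi]
  intro i
  have h1 := (EuclideanSpace.proj (𝕜 := ℝ) i).hasFDerivAt.comp_hasDerivWithinAt t (h t ht)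
  refine (Complex.ofRealCLM.hasFDerivAt.comp_hasDerivWithinAt t h1).congr_deriv ?_
  simp [complexEnd, act, Matrix.mulVec, dotProduct]

/-- Bounded flows from the standard basis vectors superpose, and uniqueness identifies the result
with the trajectory. The constant is thus independent of the trajectory, as stability requires. -/
theorem exists_norm_le_mul_norm_zero
    (hG : ∀ μ : ℂ, (complexEnd G).HasEigenvalue μ → 0 ≤ μ.re ∧ (μ.re = 0 → ∀ z : Fin N → ℂ,
      complexEnd G (complexEnd G z - μ • z) = μ • (complexEnd G z - μ • z) →
      complexEnd G z = μ • z)) :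
    ∃ K : ℝ, 0 ≤ K ∧ ∀ x : ℝ → EuclideanSpace ℝ (Fin N), IsFirstOrderSolution G x →
      ∀ t, 0 ≤ t → ‖x t‖ ≤ K * ‖x 0‖ := by
  have htop := boundedFlowSubmodule_eq_top hG
  have hbasis : ∀ i : Fin N, ∃ Z, IsComplexFlow (complexEnd G) Z ∧ Z 0 = Pi.single i 1 ∧
      ∃ C : ℝ, ∀ t, 0 ≤ t → ‖Z t‖ ≤ C := fun i => by
    have : (Pi.single i 1 : Fin N → ℂ) ∈ boundedFlowSubmodule (complexEnd G) := by
      rw [htop]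
      trivial
    exact this
  choose Z hZ hZ0 C hC using hbasis
  have hC0 : ∀ i, 0 ≤ C i := fun i => (norm_nonneg _).trans (hC i 0 le_rfl)
  let e : (Fin N → ℝ) →L[ℝ] EuclideanSpace ℝ (Fin N) :=
    ((EuclideanSpace.equiv (Fin N) ℝ).symm : (Fin N → ℝ) →L[ℝ] EuclideanSpace ℝ (Fin N))
  have hS : 0 ≤ ∑ i, C i := Finset.sum_nonneg fun i _ => hC0 i
  refine ⟨‖e‖ * ∑ i, C i, by positivity, fun x hx t ht => ?_⟩
  have hflow : IsComplexFlow (complexEnd G) fun t => ∑ i, ((x 0 i : ℝ) : ℂ) • Z i t :=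
    fun s hs => by
      refine (HasDerivWithinAt.fun_sum fun i _ =>
        (hZ i s hs).const_smul ((x 0 i : ℝ) : ℂ)).congr_deriv ?_
      simp [map_sum]
  have heq := hx.isComplexFlow.eq hflow (by
    funext i
    simp [hZ0, Finset.sum_apply, Pi.single_apply]) ht
  have hcoord : ∀ i, ‖x t i‖ ≤ (∑ i, C i) * ‖x 0‖ := fun i => by
    rw [← Complex.norm_real]
    refine (norm_le_pi_norm (fun i => ((x t i : ℝ) : ℂ)) i).trans ?_
    rw [heq, Finset.sum_mul]
    refine (norm_sum_le _ _).trans (Finset.sum_le_sum fun j _ => ?_)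
    rw [norm_smul, Complex.norm_real, mul_comm]
    exact mul_le_mul (hC j t ht) (PiLp.norm_apply_le (x 0) j) (norm_nonneg _) (hC0 j)
  calc ‖x t‖ = ‖e (x t).ofLp‖ := rfl
    _ ≤ ‖e‖ * ‖(x t).ofLp‖ := e.le_opNorm _
    _ ≤ ‖e‖ * ((∑ i, C i) * ‖x 0‖) := by
      refine mul_le_mul_of_nonneg_left ?_ (norm_nonneg _)
      exact (pi_norm_le_iff_of_nonneg (by positivity)).2 hcoord
    _ = _ := by ring

theorem firstOrderStable_of_norm_le {K : ℝ} (hK : 0 ≤ K)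
    (h : ∀ x : ℝ → EuclideanSpace ℝ (Fin N), IsFirstOrderSolution G x →
      ∀ t, 0 ≤ t → ‖x t‖ ≤ K * ‖x 0‖) : FirstOrderStable G := fun ε hε => by
  refine ⟨ε / (K + 1), by positivity, fun x hx hx0 t ht => (h x hx t ht).trans_lt ?_⟩
  rw [lt_div_iff₀ (by positivity)] at hx0
  nlinarith [norm_nonneg (x 0)]

end FirstOrder

/-! ### Skew-symmetric matrices -/

section Skew

variable {N : ℕ} {G : Matrix (Fin N) (Fin N) ℝ}

theorem dotProduct_mulVec_self_eq_zero (hG : Gᵀ = -G) (x : Fin N → ℝ) : x ⬝ᵥ G *ᵥ x = 0 := by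
  have h : x ⬝ᵥ G *ᵥ x = -(x ⬝ᵥ G *ᵥ x) := by
    conv_lhs => rw [Matrix.dotProduct_mulVec, ← Matrix.mulVec_transpose, hG, Matrix.neg_mulVec,
      neg_dotProduct, dotProduct_comm]
  linarith

/-- Take `J_i(x) = x_i (Gx)_i`, with `Q_i` symmetrized. The costs sum to `xᵀ G x = 0`, and since
`G_ii = 0` the factor `(Gx)_i` does not involve `x_i`, so it is the partial derivative. -/
theorem exists_zeroSum_quadraticCost (hG : Gᵀ = -G) :
    ∃ Q : Fin N → Matrix (Fin N) (Fin N) ℝ, (∀ i, (Q i).IsSymm) ∧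
      (∀ x, ∑ i, quadraticCost Q i x = 0) ∧
      ∀ x, pseudoGradient (quadraticCost Q) x = G *ᵥ x := by
  let P : Fin N → Matrix (Fin N) (Fin N) ℝ := fun i =>
    Matrix.vecMulVec (Pi.single i 1) (G i)
  let Q : Fin N → Matrix (Fin N) (Fin N) ℝ := fun i => (1 / 2 : ℝ) • (P i + (P i)ᵀ)
  have hP : ∀ i x, x ⬝ᵥ P i *ᵥ x = x i * (G *ᵥ x) i := fun i x => by
    simp only [P, Matrix.vecMulVec_mulVec, Matrix.mulVec]
    simp
    ring
  have hPt : ∀ i x, x ⬝ᵥ (P i)ᵀ *ᵥ x = x i * (G *ᵥ x) i := fun i x => by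
    rw [Matrix.mulVec_transpose, dotProduct_comm, ← Matrix.dotProduct_mulVec, hP]
  have hQ : ∀ i x, quadraticCost Q i x = x i * (G *ᵥ x) i := fun i x => by
    rw [quadraticCost, Matrix.smul_mulVec, Matrix.add_mulVec, dotProduct_smul, dotProduct_add,
      hP, hPt, smul_eq_mul]
    ring
  have hdiag : ∀ i, G i i = 0 := fun i => by
    have h := congrFun (congrFun hG i) i
    rw [Matrix.transpose_apply, Matrix.neg_apply] at h
    linarith
  refine ⟨Q, fun i => ?_, fun x => ?_, fun x => funext fun i => ?_⟩
  · rw [Matrix.IsSymm, Matrix.transpose_smul, Matrix.transpose_add, Matrix.transpose_transpose,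
      add_comm]
  · simp only [hQ]
    exact dotProduct_mulVec_self_eq_zero hG x
  · have h : (fun s => quadraticCost Q i (Function.update x i s)) =
        fun s => s * (G *ᵥ x) i := by
      funext s
      rw [hQ, Function.update_self]
      congr 1
      simp only [Matrix.mulVec, dotProduct]
      refine Finset.sum_congr rfl fun j _ => ?_
      rcases eq_or_ne j i with rfl | hj
      · simp [hdiag]
      · rw [Function.update_of_ne hj]
    rw [pseudoGradient, h]
    simp

theorem inner_act_self (hG : Gᵀ = -G) (x : EuclideanSpace ℝ (Fin N)) :
    inner ℝ x (act G x) = 0 := by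
  rw [EuclideanSpace.inner_eq_star_dotProduct, dotProduct_comm]
  simpa [act] using dotProduct_mulVec_self_eq_zero hG x.ofLp

/-- `x ↦ G x` as a continuous linear map. -/
noncomputable def actCLM (G : Matrix (Fin N) (Fin N) ℝ) :
    EuclideanSpace ℝ (Fin N) →L[ℝ] EuclideanSpace ℝ (Fin N) :=
  LinearMap.toContinuousLinearMap
    { toFun := act G
      map_add' := fun x y => by simp [act, Matrix.mulVec_add]
      map_smul' := fun c x => by simp [act, Matrix.mulVec_smul] }

@[simp]
theorem actCLM_apply (x : EuclideanSpace ℝ (Fin N)) : actCLM G x = act G x := rfl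

theorem IsFirstOrderSolution.norm_eq (hG : Gᵀ = -G) {x : ℝ → EuclideanSpace ℝ (Fin N)}
    (h : IsFirstOrderSolution G x) {t : ℝ} (ht : 0 ≤ t) : ‖x t‖ = ‖x 0‖ := by
  have h1 : ‖x t‖ ^ 2 = ‖x 0‖ ^ 2 := by
    refine eq_of_hasDerivWithinAt_Ici_zero (f := fun t => ‖x t‖ ^ 2) (fun s hs => ?_) ht
    refine (h s hs).norm_sq.congr_deriv ?_
    rw [inner_neg_right, inner_act_self hG]
    simp
  exact (sq_eq_sq₀ (norm_nonneg _) (norm_nonneg _)).1 h1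

theorem IsFirstOrderSolution.act {x : ℝ → EuclideanSpace ℝ (Fin N)}
    (h : IsFirstOrderSolution G x) : IsFirstOrderSolution G fun t => act G (x t) := fun t ht => by
  refine ((actCLM G).hasFDerivAt.comp_hasDerivWithinAt t (h t ht)).congr_deriv ?_
  rw [map_neg, actCLM_apply]

/-- `G x` is itself a trajectory, so its norm is constant and a limit `p` has `G p ≠ 0`. Then the
velocity tends to a nonzero vector, and `x` drifts along it without bound. -/
theorem IsFirstOrderSolution.not_tendsto (hG : Gᵀ = -G) {x : ℝ → EuclideanSpace ℝ (Fin N)}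
    (h : IsFirstOrderSolution G x) (h0 : _root_.act G (x 0) ≠ 0) :
    ¬ ∃ p, Tendsto x atTop (𝓝 p) := by
  rintro ⟨p, hp⟩
  set g := _root_.act G p with hg
  have hact : Tendsto (fun t => _root_.act G (x t)) atTop (𝓝 g) :=
    ((actCLM G).continuous.tendsto p).comp hp
  have hg0 : 0 < ‖g‖ := by
    have h1 : Tendsto (fun t => ‖_root_.act G (x t)‖) atTop (𝓝 ‖_root_.act G (x 0)‖) := by
      refine tendsto_const_nhds.congr' ?_
      filter_upwards [eventually_ge_atTop 0] with t ht
      exact (h.act.norm_eq hG ht).symm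
    rw [tendsto_nhds_unique hact.norm h1]
    exact norm_pos_iff.2 h0
  set c := ‖g‖ ^ 2 / 2 with hc
  have hc0 : 0 < c := by positivity
  have h2 : Tendsto (fun t => inner ℝ g (_root_.act G (x t))) atTop (𝓝 (‖g‖ ^ 2)) := by
    rw [← real_inner_self_eq_norm_sq]
    exact tendsto_const_nhds.inner hact
  obtain ⟨T, hT⟩ := eventually_atTop.1
    ((h2.eventually (lt_mem_nhds (half_lt_self (pow_pos hg0 2)))).and (eventually_ge_atTop 0))
  have hT0 : 0 ≤ T := (hT T le_rfl).2
  -- Eventually `⟨g, x⟩` decreases at rate at least `c`, so this sum is nonincreasing, while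
  -- convergence of `x` would send it to infinity.
  have hanti : AntitoneOn (fun t => inner ℝ g (x t) + c * t) (Set.Ici T) := by
    refine antitoneOn_Ici_of_hasDerivWithinAt_nonpos
      (f' := fun t => inner ℝ g (-(_root_.act G (x t))) + c * 1) (fun t ht => ?_) (fun t ht => ?_)
    · have h3 := (innerSL ℝ g).hasFDerivAt.comp_hasDerivWithinAt t
        ((h t (hT0.trans ht)).mono (Set.Ici_subset_Ici.2 hT0))
      exact h3.add ((hasDerivAt_id t).const_mul c).hasDerivWithinAt
    · have h3 := (hT t ht).1
      rw [inner_neg_right]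
      linarith
  have hlim : Tendsto (fun t => inner ℝ g (x t) + c * t) atTop atTop :=
    (tendsto_const_nhds.inner hp).add_atTop (tendsto_id.const_mul_atTop hc0)
  obtain ⟨t, ht, htT⟩ := ((hlim.eventually_gt_atTop (inner ℝ g (x T) + c * T)).and
    (eventually_ge_atTop T)).exists
  exact absurd (hanti (Set.mem_Ici.2 le_rfl) htT htT) (not_le.2 ht)

/-! ### Spectral decomposition -/

theorem isHermitian_I_smul (hG : Gᵀ = -G) :
    (Complex.I • G.map Complex.ofReal : Matrix (Fin N) (Fin N) ℂ).IsHermitian := by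
  ext i j
  have h := congrFun (congrFun hG i) j
  rw [Matrix.transpose_apply, Matrix.neg_apply] at h
  simp [h]

/-- A skew-symmetric matrix has a complete orthonormal system of left eigenvectors, with
imaginary eigenvalues. -/
theorem exists_orthonormalBasis_isLeftEigenvector (hG : Gᵀ = -G) :
    ∃ (e : OrthonormalBasis (Fin N) ℂ (EuclideanSpace ℂ (Fin N))) (b : Fin N → ℝ),
      ∀ j, IsLeftEigenvector G (b j * Complex.I) (e j).ofLp ∧
        G.map Complex.ofReal *ᵥ (e j).ofLp = ((b j : ℂ) * Complex.I) • (e j).ofLp := by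
  have hA := isHermitian_I_smul hG
  refine ⟨hA.eigenvectorBasis, fun j => -hA.eigenvalues j, fun j => ?_⟩
  have h0 : (hA.eigenvectorBasis j).ofLp ≠ 0 := fun h =>
    hA.eigenvectorBasis.orthonormal.ne_zero j (by
      ext i
      exact congrFun h i)
  have h1 := hA.mulVec_eigenvectorBasis j
  set u := (hA.eigenvectorBasis j).ofLp
  have h2 : G.map Complex.ofReal *ᵥ u = (((-hA.eigenvalues j : ℝ) : ℂ) * Complex.I) • u := by
    have h3 := congrArg (fun v => (-Complex.I) • v) h1
    simp only [Matrix.smul_mulVec, smul_smul, neg_mul, Complex.I_mul_I, neg_neg, one_smul] at h3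
    rw [h3]
    ext i
    simp
    ring
  refine ⟨⟨h0, ?_⟩, h2⟩
  -- The complexification is skew-Hermitian, so conjugating a right eigenvector equation with
  -- imaginary eigenvalue gives the left one, with the same vector.
  have h3 : (G.map Complex.ofReal)ᴴ = -G.map Complex.ofReal := by
    ext i k
    have h := congrFun (congrFun hG i) k
    rw [Matrix.transpose_apply, Matrix.neg_apply] at h
    simp [h]
  have h4 := congrArg star h2
  rw [Matrix.star_mulVec, h3, Matrix.vecMul_neg] at h4
  rw [← neg_inj, h4]
  ext i
  simp

theorem mode_eq_inner (e : EuclideanSpace ℂ (Fin N)) (x : EuclideanSpace ℝ (Fin N)) :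
    mode e.ofLp x = inner ℂ e (WithLp.toLp 2 fun i => (x i : ℂ)) := by
  rw [EuclideanSpace.inner_eq_star_dotProduct, mode, dotProduct_comm]

theorem norm_le_sum_norm_mode (e : OrthonormalBasis (Fin N) ℂ (EuclideanSpace ℂ (Fin N)))
    (x : EuclideanSpace ℝ (Fin N)) : ‖x‖ ≤ ∑ j, ‖mode (e j).ofLp x‖ := by
  have h1 : ‖x‖ = ‖(WithLp.toLp 2 fun i => (x i : ℂ) : EuclideanSpace ℂ (Fin N))‖ := by
    simp [EuclideanSpace.norm_eq]
  rw [h1]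
  conv_lhs => rw [← e.sum_repr' (WithLp.toLp 2 fun i => (x i : ℂ))]
  refine (norm_sum_le _ _).trans (Finset.sum_le_sum fun j _ => ?_)
  rw [norm_smul, e.orthonormal.1 j, mul_one, mode_eq_inner]

/-- An eigenvector for any other eigenvalue would be orthogonal to the whole basis. -/
theorem exists_eq_of_hasEigenvalue {e : OrthonormalBasis (Fin N) ℂ (EuclideanSpace ℂ (Fin N))}
    {ν : Fin N → ℂ} (he : ∀ j, IsLeftEigenvector G (ν j) (e j).ofLp) {μ : ℂ}
    (h : (complexEnd G).HasEigenvalue μ) : ∃ j, μ = ν j := by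
  obtain ⟨z, hz0, hz⟩ := exists_mulVec_eq_of_hasEigenvalue h
  by_contra! hne
  refine hz0 ?_
  have h1 : ∀ j, inner ℂ (e j) (WithLp.toLp 2 z) = 0 := fun j => by
    rw [EuclideanSpace.inner_eq_star_dotProduct, dotProduct_comm]
    have h2 : star (e j).ofLp ⬝ᵥ G.map Complex.ofReal *ᵥ z = μ * (star (e j).ofLp ⬝ᵥ z) := by
      rw [hz, dotProduct_smul, smul_eq_mul]
    rw [Matrix.dotProduct_mulVec, (he j).2, smul_dotProduct, smul_eq_mul] at h2
    have h3 : (μ - ν j) * (star (e j).ofLp ⬝ᵥ z) = 0 := by linear_combination -h2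
    exact (mul_eq_zero.1 h3).resolve_left (sub_ne_zero.2 (hne j))
  have h2 := e.sum_repr' (WithLp.toLp 2 z)
  simp only [h1, zero_smul, Finset.sum_const_zero] at h2
  exact (congrArg WithLp.ofLp h2).symm

/-- For the zero mode `t³ z` is constant, so the velocity is integrable. The weaker bound `C/t²` is
enough and fits `norm_sub_le_of_norm_deriv_le_div_sq`. -/
theorem IsDampedSolution.isBigO_one {t₀ : ℝ} (ht₀ : 0 < t₀) {y z : ℝ → ℂ}
    (h : IsDampedSolution 0 t₀ y z) : y =O[atTop] fun _ => (1 : ℝ) := by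
  have hz : ∀ t, t₀ ≤ t → (t : ℂ) ^ 3 * z t = (t₀ : ℂ) ^ 3 * z t₀ := fun t ht => by
    refine eq_of_hasDerivWithinAt_Ici_zero (f := fun t : ℝ => (t : ℂ) ^ 3 * z t)
      (fun s hs => ?_) ht
    have hsC : (s : ℂ) ≠ 0 := by exact_mod_cast (ht₀.trans_le hs).ne'
    have h1 : HasDerivAt (fun s : ℝ => ((s : ℂ))) 1 s := Complex.ofRealCLM.hasDerivAt
    refine ((h1.pow 3).hasDerivWithinAt.mul (h s hs).2).congr_deriv ?_
    simp only [Pi.pow_apply]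
    push_cast
    field_simp
    ring
  set C := t₀ ^ 2 * ‖z t₀‖ with hC
  have hbound : ∀ t, t₀ ≤ t → ‖z t‖ ≤ C / t ^ 2 := fun t ht => by
    have ht0 : 0 < t := ht₀.trans_le ht
    have h1 := congrArg norm (hz t ht)
    rw [norm_mul, norm_mul, norm_pow, norm_pow, Complex.norm_real, Complex.norm_real,
      Real.norm_of_nonneg ht0.le, Real.norm_of_nonneg ht₀.le] at h1
    rw [le_div_iff₀ (by positivity), hC]
    have h2 : t₀ ^ 3 * ‖z t₀‖ ≤ t * (t₀ ^ 2 * ‖z t₀‖) := by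
      have : 0 ≤ t₀ ^ 2 * ‖z t₀‖ := by positivity
      nlinarith
    refine le_of_mul_le_mul_left ?_ ht0
    linarith
  refine IsBigO.of_bound (‖y t₀‖ + C / t₀) ?_
  filter_upwards [eventually_ge_atTop t₀] with t ht
  have ht0 : 0 < t := ht₀.trans_le ht
  have h1 := norm_sub_le_of_norm_deriv_le_div_sq ht₀ (fun t ht => (h t ht).1) hbound le_rfl ht
  have h2 : 0 ≤ C / t := by positivity
  have h3 := norm_le_norm_add_norm_sub' (y t) (y t₀)
  rw [norm_one, mul_one]
  linarith

theorem one_isBigO_growthProfile {β : ℝ} (hβ : 0 < β) :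
    (fun _ => (1 : ℝ)) =O[atTop] growthProfile β := by
  refine IsBigO.of_bound 1 ?_
  filter_upwards [(tendsto_growthProfile hβ).eventually_ge_atTop 1] with t ht
  rw [norm_one, one_mul]
  exact ht.trans (le_abs_self _)

/-- Each mode grows at most at its own rate, which is monotone in `|b j|`; zero modes stay bounded.
The orthonormal basis turns these into a bound on the norm. -/
theorem IsNAGDSolution.isBigO_growthProfile
    {e : OrthonormalBasis (Fin N) ℂ (EuclideanSpace ℂ (Fin N))} {b : Fin N → ℝ}
    (he : ∀ j, IsLeftEigenvector G (b j * Complex.I) (e j).ofLp) {B : ℝ} (hB : B ≠ 0)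
    (hbB : ∀ j, |b j| ≤ |B|) {t₀ : ℝ} (ht₀ : 0 < t₀) {q v : ℝ → EuclideanSpace ℝ (Fin N)}
    (h : IsNAGDSolution G t₀ q v) :
    (fun t => ‖q t‖) =O[atTop] growthProfile √(|B| / 2) := by
  have hmode : ∀ j, (fun t => ‖_root_.mode (e j).ofLp (q t)‖) =O[atTop]
      growthProfile √(|B| / 2) := fun j => by
    have hd := h.mode (he j).2
    rw [isBigO_norm_left]
    by_cases hj : b j = 0
    · rw [hj, Complex.ofReal_zero, zero_mul] at hd
      exact (hd.isBigO_one ht₀).trans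
        (one_isBigO_growthProfile (Real.sqrt_pos.2 (by positivity)))
    · obtain ⟨l₁, l₂, -, hlim⟩ := exists_norm_growth_functional hj ht₀
      refine (isBigO_growthProfile_of_tendsto (hlim _ _ hd)).trans (growthProfile_isBigO ?_)
      exact Real.sqrt_le_sqrt (by linarith [hbB j])
  refine IsBigO.trans (IsBigO.of_bound 1 (Eventually.of_forall fun t => ?_))
    (IsBigO.sum fun j (_ : j ∈ Finset.univ) => hmode j)
  rw [norm_norm, one_mul, Finset.sum_apply]
  exact (norm_le_sum_norm_mode e (q t)).trans (le_abs_self _)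

/-- If all eigenvalues vanished, every modal coordinate of `G x` would vanish, and the basis is
complete. -/
theorem exists_ne_zero_of_ne_zero
    {e : OrthonormalBasis (Fin N) ℂ (EuclideanSpace ℂ (Fin N))} {b : Fin N → ℝ}
    (he : ∀ j, IsLeftEigenvector G (b j * Complex.I) (e j).ofLp) (hG : G ≠ 0) :
    ∃ j, b j ≠ 0 := by
  by_contra! hb
  refine hG ?_
  have h1 : ∀ x, act G x = 0 := fun x => by
    rw [← norm_le_zero_iff]
    refine (norm_le_sum_norm_mode e _).trans (Finset.sum_nonpos fun j _ => ?_)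
    rw [mode_act (he j).2, hb j]
    simp
  ext i j
  have h2 := congrArg (fun x : EuclideanSpace ℝ (Fin N) => x i) (h1 (EuclideanSpace.single j 1))
  simpa [act] using h2

end Skew

/-! ### Assembly of the general and the skew-symmetric case -/

theorem mainTheorem7 {N : ℕ} (G : Matrix (Fin N) (Fin N) ℝ) :
    -- an arbitrary `G` with a purely imaginary eigenvalue `i b`, `b ≠ 0`
    (∀ b : ℝ, b ≠ 0 → (complexEnd G).HasEigenvalue (b * Complex.I) →
      -- first-order dynamics: the modes of `i b` rotate on circles, for every trajectory
      (∀ w : Fin N → ℂ, IsLeftEigenvector G (b * Complex.I) w →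
        ∀ x : ℝ → EuclideanSpace ℝ (Fin N), IsFirstOrderSolution G x → ∀ t, 0 ≤ t →
          mode w (x t) = Complex.exp (-(b * Complex.I * t)) * mode w (x 0) ∧
          ‖mode w (x t)‖ = ‖mode w (x 0)‖) ∧
      -- there are nonconstant periodic trajectories, of period `2π/|b|`
      (∃ x : ℝ → EuclideanSpace ℝ (Fin N), IsFirstOrderSolution G x ∧
        (∀ t, 0 ≤ t → x (t + 2 * Real.pi / |b|) = x t) ∧ ∃ t, 0 ≤ t ∧ x t ≠ x 0) ∧
      ¬ FirstOrderAsymptoticallyStable G ∧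
      -- if no other mode is unstable, the whole system is marginally stable and bounded
      ((∀ μ : ℂ, (complexEnd G).HasEigenvalue μ → 0 ≤ μ.re ∧
          (μ.re = 0 → ∀ z : Fin N → ℂ,
            complexEnd G (complexEnd G z - μ • z) = μ • (complexEnd G z - μ • z) →
            complexEnd G z = μ • z)) →
        FirstOrderMarginallyStable G ∧
        ∀ x : ℝ → EuclideanSpace ℝ (Fin N), IsFirstOrderSolution G x →
          ∃ C : ℝ, ∀ t, 0 ≤ t → ‖x t‖ ≤ C) ∧
      -- accelerated dynamics: exponential instability with rate `√(|b|/2)`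
      (∀ t₀ : ℝ, 0 < t₀ →
        ¬ NAGDStable G t₀ ∧
        -- the modes of `i b` grow at exactly this rate, outside a subspace of codimension two
        (∀ w : Fin N → ℂ, IsLeftEigenvector G (b * Complex.I) w →
          ∃ E : Submodule ℝ (EuclideanSpace ℝ (Fin N) × EuclideanSpace ℝ (Fin N)),
            Module.finrank ℝ E + 2 = 2 * N ∧
            ∀ q v : ℝ → EuclideanSpace ℝ (Fin N), IsNAGDSolution G t₀ q v →
              (q t₀, v t₀) ∉ E →
              ∃ C : ℝ, 0 < C ∧
                Tendsto (fun t => ‖mode w (q t)‖ / growthProfile √(|b| / 2) t) atTop (𝓝 C)) ∧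
        -- hence generic trajectories grow at least at this rate
        (∃ E : Submodule ℝ (EuclideanSpace ℝ (Fin N) × EuclideanSpace ℝ (Fin N)),
          Module.finrank ℝ E + 2 = 2 * N ∧
          ∀ q v : ℝ → EuclideanSpace ℝ (Fin N), IsNAGDSolution G t₀ q v →
            (q t₀, v t₀) ∉ E →
            growthProfile √(|b| / 2) =O[atTop] (fun t => ‖q t‖)) ∧
        -- and arbitrarily small initial data lead to growth at exactly this rate
        (∀ ε : ℝ, 0 < ε → ∃ q v : ℝ → EuclideanSpace ℝ (Fin N), IsNAGDSolution G t₀ q v ∧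
          ‖q t₀‖ + ‖v t₀‖ < ε ∧
          (fun t => ‖q t‖) =Θ[atTop] growthProfile √(|b| / 2)))) ∧
    -- skew-symmetric `G`, as in zero-sum games
    (Gᵀ = -G →
      -- `G` is the pseudo-gradient matrix of a quadratic zero-sum game
      (∃ Q : Fin N → Matrix (Fin N) (Fin N) ℝ, (∀ i, (Q i).IsSymm) ∧
        (∀ x, ∑ i, quadraticCost Q i x = 0) ∧
        ∀ x, pseudoGradient (quadraticCost Q) x = G *ᵥ x) ∧
      (∀ μ : ℂ, (complexEnd G).HasEigenvalue μ → μ.re = 0) ∧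
      -- first-order trajectories stay on spheres and, unless at rest, do not settle
      (∀ x : ℝ → EuclideanSpace ℝ (Fin N), IsFirstOrderSolution G x →
        (∀ t, 0 ≤ t → ‖x t‖ = ‖x 0‖) ∧
        (act G (x 0) ≠ 0 → ¬ ∃ p, Tendsto x atTop (𝓝 p))) ∧
      (G ≠ 0 →
        FirstOrderMarginallyStable G ∧
        -- the first part applies, and for the largest `|b|` the rate is that of the whole system
        ∃ b : ℝ, b ≠ 0 ∧ (complexEnd G).HasEigenvalue (b * Complex.I) ∧
          (∀ μ : ℂ, (complexEnd G).HasEigenvalue μ → ‖μ‖ ≤ |b|) ∧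
          ∀ t₀ : ℝ, 0 < t₀ →
            (∀ q v : ℝ → EuclideanSpace ℝ (Fin N), IsNAGDSolution G t₀ q v →
              (fun t => ‖q t‖) =O[atTop] growthProfile √(|b| / 2)) ∧
            ∃ E : Submodule ℝ (EuclideanSpace ℝ (Fin N) × EuclideanSpace ℝ (Fin N)),
              Module.finrank ℝ E + 2 = 2 * N ∧
              ∀ q v : ℝ → EuclideanSpace ℝ (Fin N), IsNAGDSolution G t₀ q v →
                (q t₀, v t₀) ∉ E →
                (fun t => ‖q t‖) =Θ[atTop] growthProfile √(|b| / 2))) := by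
  refine ⟨fun b hb h => ?_, fun hG => ?_⟩
  · refine ⟨fun w hw x hx t ht => ?_, exists_periodic_firstOrderSolution hb h,
      not_firstOrderAsymptoticallyStable hb h, fun hspec => ?_, fun t₀ ht₀ => ?_⟩
    · have h1 := hx.mode_eq hw.2 ht
      exact ⟨h1, by rw [h1, norm_mul, norm_cexp_neg_mul_I, one_mul]⟩
    · obtain ⟨K, hK, hbound⟩ := exists_norm_le_mul_norm_zero hspec
      exact ⟨⟨firstOrderStable_of_norm_le hK hbound, not_firstOrderAsymptoticallyStable hb h⟩,
        fun x hx => ⟨_, hbound x hx⟩⟩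
    · exact ⟨not_nagdStable hb h ht₀, fun w hw => hw.exists_submodule hb ht₀,
        exists_submodule_growthProfile_isBigO hb h ht₀,
        fun ε hε => exists_isNAGDSolution_small hb h ht₀ hε⟩
  · obtain ⟨e, b, he⟩ := exists_orthonormalBasis_isLeftEigenvector hG
    have hleft := fun j => (he j).1
    refine ⟨exists_zeroSum_quadraticCost hG, fun μ hμ => ?_,
      fun x hx => ⟨fun t ht => hx.norm_eq hG ht, hx.not_tendsto hG⟩, fun hG0 => ?_⟩
    · obtain ⟨j, rfl⟩ := exists_eq_of_hasEigenvalue hleft hμ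
      simp
    · obtain ⟨i, hi⟩ := exists_ne_zero_of_ne_zero hleft hG0
      have : Nonempty (Fin N) := ⟨i⟩
      -- The mode with largest `|b j|` gives at once the spectral radius, the upper bound for all
      -- trajectories and the generic lower bound.
      obtain ⟨m, hm⟩ := Finite.exists_max fun j => |b j|
      have hm0 : b m ≠ 0 := abs_pos.1 ((abs_pos.2 hi).trans_le (hm i))
      have heig : (complexEnd G).HasEigenvalue (b m * Complex.I) :=
        Module.End.hasEigenvalue_of_hasEigenvector (x := (e m).ofLp)
          (Module.End.hasEigenvector_iff.2
            ⟨Module.End.mem_eigenspace_iff.2 (by simpa [complexEnd] using (he m).2), (hleft m).1⟩)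
      refine ⟨⟨firstOrderStable_of_norm_le zero_le_one fun x hx t ht => ?_,
        not_firstOrderAsymptoticallyStable hm0 heig⟩, b m, hm0, heig, fun μ hμ => ?_,
        fun t₀ ht₀ => ?_⟩
      · rw [one_mul, hx.norm_eq hG ht]
      · obtain ⟨j, rfl⟩ := exists_eq_of_hasEigenvalue hleft hμ
        simpa using hm j
      · have hO : ∀ q v : ℝ → EuclideanSpace ℝ (Fin N), IsNAGDSolution G t₀ q v →
            (fun t => ‖q t‖) =O[atTop] growthProfile √(|b m| / 2) :=
          fun q v hqv => hqv.isBigO_growthProfile hleft hm0 hm ht₀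
        obtain ⟨E, hE, hgrow⟩ := exists_submodule_growthProfile_isBigO hm0 heig ht₀
        exact ⟨hO, E, hE, fun q v hqv hmem => ⟨hO q v hqv, hgrow q v hqv hmem⟩⟩
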